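/- Let $\mathbb{Z}_\infty=\mathbb{Z}\cup\{+\infty\}$, with $a+\infty=\infty$ for all $a$. For a matrix $A=(a_{ij})\in\mathbb{Z}_\infty^{m\times n}$, a vector $x\in\mathbb{Z}_\infty^{n}$ with $x\neq(\infty,\ldots,\infty)$ is a solution of the tropical linear system $A$ if for every row $1\le i\le m$ there are two columns $1\le k<l\le n$ with $$a_{ik}+x_k=a_{il}+x_l=\min_{1\le j\le n}\{a_{ij}+x_j\}$$ (this minimum is allowed to be $\infty$). A vector $l\in\mathbb{Z}_\infty^{n}$ is regarded as a single tropical linear equation (a system with one row). Consider the following two decision problems, whose instances are written as words over a finite alphabet, with the integers in binary. - $\mathrm{TropSolv}_\infty$: given $A\in\mathbb{Z}_\infty^{m\times n}$, decide whether the tropical linear system $A$ has a solution in $\mathbb{Z}_\infty^n$. - $\mathrm{TropImpl}_\infty$: given $A\in\mathbb{Z}_\infty^{m\times n}$ and $l\in\mathbb{Z}_\infty^{n}$, decide whether $A$ implies $l$, that is, whether every solution $x\in\mathbb{Z}_\infty^n$ of the system $A$ also satisfies the equation $l$. **Theorem.** $\mathrm{TropImpl}_\infty\le_T\mathrm{TropSolv}_\infty$,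 where $\le_T$ denotes polynomial time Turing reducibility: there is a deterministic oracle machine which, given an oracle for $\mathrm{TropSolv}_\infty$, decides every instance of $\mathrm{TropImpl}_\infty$ in a number of steps bounded by a polynomial in the length of the instance. -/

import Mathlib

namespace TropicalReduction

/-! ## Tropical linear systems over `ℤ ∪ {∞}` -/

/-- The scalars `ℤ ∪ {+∞}`, with `min` as tropical addition and `+` as tropical multiplication
(so `∞ + a = ∞`). -/
abbrev ZInf : Type := WithTop ℤ

/-- The vector `x` satisfies the tropical linear equation with coefficient vector `a`: the minimum
of the `a j + x j` is attained in at least two different columns. The minimum may be `∞`. -/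
def SatisfiesRow {n : ℕ} (a x : Fin n → ZInf) : Prop :=
  ∃ k l : Fin n, k < l ∧ a k + x k = a l + x l ∧
    a l + x l = Finset.univ.inf fun j => a j + x j

/-- `x` is a solution of the tropical linear system with matrix `A`: it is not the vector
`(∞, …, ∞)`, and it satisfies every row. -/
def IsSolution {m n : ℕ} (A : Matrix (Fin m) (Fin n) ZInf) (x : Fin n → ZInf) : Prop :=
  x ≠ (fun _ => ⊤) ∧ ∀ i, SatisfiesRow (A i) x

/-- The system `A` is solvable over `ℤ ∪ {∞}`. -/
def Solvable {m n : ℕ} (A : Matrix (Fin m) (Fin n) ZInf) : Prop :=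
  ∃ x, IsSolution A x

/-- The system `A` implies the tropical linear equation `l` over `ℤ ∪ {∞}`. -/
def Implies {m n : ℕ} (A : Matrix (Fin m) (Fin n) ZInf) (l : Fin n → ZInf) : Prop :=
  ∀ x, IsSolution A x → SatisfiesRow l x

/-! ## Words -/

/-- The finite alphabet in which instances of the problems are written. -/
inductive Symbol
  | bit (b : Bool)
  | minus
  | infty
  | comma
  | semicolon
  deriving DecidableEq, Fintype

/-- Binary notation of an integer, least significant bit first, without superfluous zeros, and
preceded by a minus sign if the integer is negative. -/
def encodeInt (z : ℤ) : List Symbol :=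
  (if z < 0 then [Symbol.minus] else []) ++ (Computability.encodeNat z.natAbs).map Symbol.bit

/-- Notation of an element of `ℤ ∪ {∞}`. -/
def encodeEntry : ZInf → List Symbol
  | none => [Symbol.infty]
  | some z => encodeInt z

/-- The entries of a vector, each followed by a comma. -/
def encodeVector {n : ℕ} (v : Fin n → ZInf) : List Symbol :=
  (List.ofFn v).flatMap fun a => encodeEntry a ++ [Symbol.comma]

/-- The number of columns in unary and a semicolon, then the rows, each followed by a semicolon. -/
def encodeMatrix {m n : ℕ} (A : Matrix (Fin m) (Fin n) ZInf) : List Symbol :=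
  (List.replicate n (Symbol.bit true) ++ [Symbol.semicolon]) ++
    (List.ofFn fun i => A i).flatMap fun r => encodeVector r ++ [Symbol.semicolon]

theorem append_cons_inj_of_notMem {α : Type} {t : α} :
    ∀ {u v r s : List α}, t ∉ u → t ∉ v → u ++ t :: r = v ++ t :: s → u = v ∧ r = s
  | [], [], _, _, _, _, h => by simpa using h
  | [], b :: v, _, _, _, hv, h => by simp_all
  | a :: u, [], _, _, hu, _, h => by simp_all
  | a :: u, b :: v, r, s, hu, hv, h => by
    simp only [List.cons_append, List.cons.injEq] at h
    have := append_cons_inj_of_notMem (t := t) (by simp_all) (by simp_all) h.2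
    exact ⟨by rw [h.1, this.1], this.2⟩

theorem flatMap_terminated_injective {α β : Type} {f : α → List β} {t : β}
    (hf : Function.Injective f) (ht : ∀ a, t ∉ f a) :
    Function.Injective fun L : List α => L.flatMap fun a => f a ++ [t] := by
  intro L
  induction L with
  | nil =>
    intro L' h
    cases L' with
    | nil => rfl
    | cons b L' => simp at h
  | cons a L ih =>
    intro L' h
    cases L' with
    | nil => simp at h
    | cons b L' =>
      simp only [List.flatMap_cons, List.append_assoc, List.singleton_append] at h
      obtain ⟨h1, h2⟩ := append_cons_inj_of_notMem (ht a) (ht b) h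
      rw [hf h1, ih h2]

theorem encodeNat_injective : Function.Injective Computability.encodeNat :=
  Computability.encodingNatBool.encode_injective

theorem encodeInt_injective : Function.Injective encodeInt := by
  intro a b h
  have inj : ∀ x y : ℕ, (Computability.encodeNat x).map Symbol.bit =
      (Computability.encodeNat y).map Symbol.bit → x = y := fun x y hxy =>
    encodeNat_injective (List.map_injective_iff.2 (fun _ _ e => by simpa using e) hxy)
  have nomem : ∀ (x : ℕ) (w : List Symbol),
      (Computability.encodeNat x).map Symbol.bit ≠ Symbol.minus :: w := by
    intro x w hw
    have : Symbol.minus ∈ (Computability.encodeNat x).map Symbol.bit := by simp [hw]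
    simp at this
  unfold encodeInt at h
  split_ifs at h with ha hb hb
  · simp only [List.singleton_append, List.cons.injEq, true_and] at h
    have := inj _ _ h
    omega
  · exact absurd h.symm (nomem _ _)
  · exact absurd h (nomem _ _)
  · simp only [List.nil_append] at h
    have := inj _ _ h
    omega

theorem mem_encodeEntry {s : Symbol} {a : ZInf} (h : s ∈ encodeEntry a) :
    s ≠ Symbol.comma ∧ s ≠ Symbol.semicolon := by
  rcases a with _ | z
  · simp only [encodeEntry, List.mem_singleton] at h
    subst h
    simp
  · simp only [encodeEntry, encodeInt, List.mem_append, List.mem_map] at h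
    rcases h with h | ⟨b, -, rfl⟩
    · split_ifs at h
      · simp only [List.mem_singleton] at h
        subst h
        simp
      · simp at h
    · simp

theorem encodeEntry_injective : Function.Injective encodeEntry := by
  have nomem : ∀ z : ℤ, Symbol.infty ∉ encodeInt z := by
    intro z h
    simp only [encodeInt, List.mem_append, List.mem_map] at h
    rcases h with h | ⟨b, -, hb⟩
    · split_ifs at h <;> simp at h
    · simp at hb
  rintro (_ | a) (_ | b) h
  · rfl
  · exact absurd (show Symbol.infty ∈ encodeInt b by
      have h' : [Symbol.infty] = encodeInt b := h
      simp [← h']) (nomem b)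
  · exact absurd (show Symbol.infty ∈ encodeInt a by
      have h' : encodeInt a = [Symbol.infty] := h
      simp [h']) (nomem a)
  · exact congrArg some (encodeInt_injective h)

theorem encodeVector_injective (n : ℕ) :
    Function.Injective (encodeVector : (Fin n → ZInf) → List Symbol) := by
  intro v w h
  exact List.ofFn_injective
    (flatMap_terminated_injective encodeEntry_injective (fun a ha => (mem_encodeEntry ha).1 rfl) h)

theorem semicolon_notMem_encodeVector {n : ℕ} (v : Fin n → ZInf) :
    Symbol.semicolon ∉ encodeVector v := by
  intro h
  simp only [encodeVector, List.mem_flatMap, List.mem_append, List.mem_singleton] at h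
  obtain ⟨a, -, h | h⟩ := h
  · exact (mem_encodeEntry h).2 rfl
  · simp at h

theorem encodeMatrix_inj {m n m' n' : ℕ} {A : Matrix (Fin m) (Fin n) ZInf}
    {B : Matrix (Fin m') (Fin n') ZInf} (h : encodeMatrix A = encodeMatrix B) :
    n = n' ∧ m = m' ∧ A ≍ B := by
  simp only [encodeMatrix, List.append_assoc, List.singleton_append] at h
  obtain ⟨h1, h2⟩ := append_cons_inj_of_notMem (by simp) (by simp) h
  have hn : n = n' := by simpa using congrArg List.length h1
  subst hn
  have h3 := flatMap_terminated_injective (encodeVector_injective n)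
    semicolon_notMem_encodeVector h2
  have hm : m = m' := by
    have h4 := congrArg List.length h3
    exact (List.length_ofFn (f := fun i => A i)).symm.trans
      (h4.trans (List.length_ofFn (f := fun i => B i)))
  subst hm
  exact ⟨rfl, rfl, heq_of_eq (List.ofFn_injective h3)⟩

/-! ## Decision problems -/

/-- A decision problem: instances, written as words in an injective way, and the property of
instances that has to be decided. -/
structure DecisionProblem where
  Instance : Type
  encode : Instance → List Symbol
  encode_injective : Function.Injective encode
  IsYes : Instance → Prop

/-- The language of a decision problem: the words that encode a `yes` instance. -/
def DecisionProblem.language (P : DecisionProblem) : Set (List Symbol) :=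
  {w | ∃ a, P.encode a = w ∧ P.IsYes a}

/-- An `m × n` matrix over `ℤ ∪ {∞}`, of any size. -/
structure SolvInstance where
  m : ℕ
  n : ℕ
  A : Matrix (Fin m) (Fin n) ZInf

/-- An `m × n` matrix over `ℤ ∪ {∞}` and a vector over `ℤ ∪ {∞}` of length `n`. -/
structure ImplInstance where
  m : ℕ
  n : ℕ
  A : Matrix (Fin m) (Fin n) ZInf
  l : Fin n → ZInf

/-- Solvability of tropical linear systems over `ℤ ∪ {∞}`. -/
def TropSolvInf : DecisionProblem where
  Instance := SolvInstance
  encode a := encodeMatrix a.A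
  encode_injective := by
    rintro ⟨m, n, A⟩ ⟨m', n', A'⟩ h
    obtain ⟨rfl, rfl, h3⟩ := encodeMatrix_inj h
    cases h3
    rfl
  IsYes a := Solvable a.A

/-- Implication of a tropical linear equation by a tropical linear system over `ℤ ∪ {∞}`. -/
def TropImplInf : DecisionProblem where
  Instance := ImplInstance
  encode a := encodeVector a.l ++ Symbol.semicolon :: encodeMatrix a.A
  encode_injective := by
    rintro ⟨m, n, A, l⟩ ⟨m', n', A', l'⟩ h
    obtain ⟨h1, h2⟩ := append_cons_inj_of_notMem (semicolon_notMem_encodeVector _)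
      (semicolon_notMem_encodeVector _) h
    obtain ⟨rfl, rfl, h3⟩ := encodeMatrix_inj h2
    cases h3
    cases encodeVector_injective _ h1
    rfl
  IsYes a := Implies a.A a.l

/-! ## Oracle machines and polynomial time Turing reductions -/

/-- A deterministic oracle machine: a multi-stack Turing machine (Mathlib's `TM2` model, with
finitely many stacks, labels and internal states), some of whose labels are query labels. -/
structure OracleMachine where
  /-- the stacks -/
  K : Type
  [decEqK : DecidableEq K]
  [finK : Fintype K]
  /-- the stack that holds the input word at the start, first symbol on top -/
  inputStk : K
  /-- the stack that holds the word that the oracle is asked about, first symbol on top -/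
  queryStk : K
  /-- the labels of the program -/
  Λ : Type
  [finΛ : Fintype Λ]
  /-- the label at which the computation starts -/
  start : Λ
  /-- the internal states -/
  σ : Type
  [finσ : Fintype σ]
  /-- the internal state in which the computation starts -/
  init : σ
  /-- A label carries either an ordinary statement or an oracle query, in which case the next
  label is determined by the oracle's answer. -/
  instr : Λ → Turing.TM2.Stmt (fun _ : K => Symbol) Λ σ ⊕ (Bool → Λ)
  /-- the internal states in which a halting computation accepts -/
  accept : σ → Bool

namespace OracleMachine

instance (M : OracleMachine) : DecidableEq M.K := M.decEqK

/-- Configurations: the current label (`none` after halting), the internal state, the stacks. -/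
abbrev Cfg (M : OracleMachine) : Type := Turing.TM2.Cfg (fun _ : M.K => Symbol) M.Λ M.σ

/-- The initial configuration on the input word `w`: all stacks but the input stack are empty. -/
def initCfg (M : OracleMachine) (w : List Symbol) : M.Cfg :=
  ⟨some M.start, M.init, Function.update (fun _ => []) M.inputStk w⟩

open Classical in
/-- One step of the machine with the oracle `O`; there is none after halting. A query takes one
step: it jumps according to whether the word on the query stack is in `O`, and erases that
word. -/
noncomputable def step (M : OracleMachine) (O : Set (List Symbol)) : M.Cfg → Option M.Cfg
  | ⟨none, _, _⟩ => none
  | ⟨some lab, v, S⟩ =>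
    match M.instr lab with
    | Sum.inl q => some (Turing.TM2.stepAux q v S)
    | Sum.inr next =>
      some ⟨some (next (decide (S M.queryStk ∈ O))), v, Function.update S M.queryStk []⟩

/-- The configuration after exactly `t` steps on the input word `w`, if there is one. -/
noncomputable def run (M : OracleMachine) (O : Set (List Symbol)) (w : List Symbol) :
    ℕ → Option M.Cfg
  | 0 => some (M.initCfg w)
  | t + 1 => (M.run O w t).bind (M.step O)

/-- With the oracle `O` and on the input word `w`, the machine halts after at most `T` steps, with
the answer `b`. -/
def HaltsWithin (M : OracleMachine) (O : Set (List Symbol)) (w : List Symbol) (T : ℕ)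
    (b : Bool) : Prop :=
  ∃ t ≤ T, ∃ c, M.run O w t = some c ∧ c.l = none ∧ M.accept c.var = b

end OracleMachine

open Classical in
/-- `P ≤_T Q`, polynomial time Turing reducibility: some oracle machine with an oracle for `Q`
decides every instance of `P` in a number of steps that is bounded by a polynomial in the length
of the instance. -/
def PolyTimeTuringReducible (P Q : DecisionProblem) : Prop :=
  ∃ (M : OracleMachine) (p : Polynomial ℕ), ∀ a : P.Instance,
    M.HaltsWithin Q.language (P.encode a) (p.eval (P.encode a).length) (decide (P.IsYes a))

end TropicalReduction

namespace TropicalReduction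

/-! Suppose there are at least two columns. The equation `l` fails at `x` exactly when the minimum
of the `l k + x k` is attained in a single column `j`, and that minimum is then finite. So `A` does
not imply `l` iff for some `j` there is a solution of `A` with `l j + x j` finite and `l j + (1 + x
j) ≤ l k + x k` for all `k ≠ j`. One oracle query per column suffices once these conditions are
tropical equations.

An inequality `d + y ≤ c + x k` becomes an equation when `y` occupies two columns: with the
coefficient `d` in both and `c` in column `k`, the minimum is attained twice unless column `k` lies
strictly below. Each query therefore has two additional columns, forced to equal `1 + x j`
(`exists_satisfies_queryRows_iff`).

Finiteness is imposed by the inequalities `l j + (1 + x j) ≤ C + x k` for all `k`, since some `x k`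
is finite. They also exclude solutions with entries far below `x j`; the heart of the proof is that
nothing is lost when `C` is large (`exists_solution_bounded_below`). If the entries below `x j`
leave a gap that is wide compared with the bound `M` on the coefficients, all entries below the gap
can be raised by one (`SatisfiesRow.raise`). Once no gap is left, every entry is at least `x j - n *
(2 * M + 1)`. The choice `C = 2 ^ W - 1`, with `W` the length of the input, is large enough
(`implies_iff_notMem_language`) and is written as `W` digits one.

For the machine, structured stack programs with a step-counting semantics are compiled to oracle
machines (`Prog.Exec.reaches`). The reduction is such a program and runs in cubic time
(`exec_reduction`). -/

theorem satisfiesRow_iff {n : ℕ} {a x : Fin n → ZInf} :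
    SatisfiesRow a x ↔ ∃ k l : Fin n, k ≠ l ∧ a k + x k = a l + x l ∧
      ∀ i, a l + x l ≤ a i + x i := by
  constructor
  · rintro ⟨k, l, hkl, h, hm⟩
    exact ⟨k, l, hkl.ne, h, fun i => hm ▸ Finset.inf_le (Finset.mem_univ i)⟩
  · rintro ⟨k, l, hkl, h, hm⟩
    have key : a l + x l = Finset.univ.inf fun j => a j + x j :=
      le_antisymm (Finset.le_inf fun i _ => hm i) (Finset.inf_le (Finset.mem_univ l))
    rcases lt_or_gt_of_ne hkl with h' | h'
    · exact ⟨k, l, h', h, key⟩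
    · exact ⟨l, k, h', h.symm, h.trans key⟩

/-! ### Tropical rows with two additional columns -/

/-- The vector obtained from `u` by appending the two entries `a` and `b`. -/
def extend {n : ℕ} (u : Fin n → ZInf) (a b : ZInf) : Fin (n + 2) → ZInf :=
  Fin.snoc (α := fun _ => ZInf) (Fin.snoc (α := fun _ => ZInf) u a) b

@[simp] theorem extend_castSucc_castSucc {n : ℕ} (u : Fin n → ZInf) (a b : ZInf) (i : Fin n) :
    extend u a b i.castSucc.castSucc = u i := by simp [extend]

@[simp] theorem extend_castSucc_last {n : ℕ} (u : Fin n → ZInf) (a b : ZInf) :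
    extend u a b (Fin.last n).castSucc = a := by simp [extend]

@[simp] theorem extend_last {n : ℕ} (u : Fin n → ZInf) (a b : ZInf) :
    extend u a b (Fin.last (n + 1)) = b := by simp [extend]

theorem forall_fin_add_two {n : ℕ} {p : Fin (n + 2) → Prop} :
    (∀ i, p i) ↔ (∀ i : Fin n, p i.castSucc.castSucc) ∧ p (Fin.last n).castSucc ∧
      p (Fin.last (n + 1)) := by
  rw [Fin.forall_fin_succ', Fin.forall_fin_succ', and_assoc]

theorem exists_fin_add_two {n : ℕ} {p : Fin (n + 2) → Prop} :
    (∃ i, p i) ↔ (∃ i : Fin n, p i.castSucc.castSucc) ∨ p (Fin.last n).castSucc ∨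
      p (Fin.last (n + 1)) := by
  rw [Fin.exists_fin_succ', Fin.exists_fin_succ', or_assoc]

theorem exists_extend {n : ℕ} (v : Fin (n + 2) → ZInf) : ∃ u a b, v = extend u a b :=
  ⟨fun i => v i.castSucc.castSucc, v (Fin.last n).castSucc, v (Fin.last (n + 1)),
    funext (forall_fin_add_two.2 (by simp))⟩

theorem extend_eq_top {n : ℕ} {u : Fin n → ZInf} {a b : ZInf} :
    (extend u a b = fun _ => ⊤) ↔ (u = fun _ => ⊤) ∧ a = ⊤ ∧ b = ⊤ := by
  simp only [funext_iff, forall_fin_add_two, extend_castSucc_castSucc, extend_castSucc_last,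
    extend_last]

/-- The additional columns have the value `∞`, so they can be minimisers only if every column is
`∞`. Then two of the first `n` columns serve instead, which is where `2 ≤ n` enters. -/
theorem satisfiesRow_extend_top {n : ℕ} (hn : 2 ≤ n) (a x : Fin n → ZInf) (y z : ZInf) :
    SatisfiesRow (extend a ⊤ ⊤) (extend x y z) ↔ SatisfiesRow a x := by
  rw [satisfiesRow_iff, satisfiesRow_iff]
  constructor
  · rintro ⟨k, l, hkl, h, hm⟩
    by_cases htop : extend a ⊤ ⊤ l + extend x y z l = ⊤
    · have hall : ∀ i, a i + x i = ⊤ := fun i => by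
        simpa [htop] using hm i.castSucc.castSucc
      exact ⟨⟨0, by omega⟩, ⟨1, by omega⟩, by simp, by simp [hall], fun i => by simp [hall]⟩
    · have key : ∀ i : Fin (n + 2), extend a ⊤ ⊤ i + extend x y z i ≠ ⊤ →
          ∃ i' : Fin n, i = i'.castSucc.castSucc := by
        intro i
        refine forall_fin_add_two (p := fun i => extend a ⊤ ⊤ i + extend x y z i ≠ ⊤ →
          ∃ i' : Fin n, i = i'.castSucc.castSucc) |>.2 ⟨fun i _ => ⟨i, rfl⟩, ?_, ?_⟩ i <;> simp
      obtain ⟨l', rfl⟩ := key l htop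
      obtain ⟨k', rfl⟩ := key k (h ▸ htop)
      refine ⟨k', l', fun e => hkl (by rw [e]), by simpa using h, fun i => by
        simpa using hm i.castSucc.castSucc⟩
  · rintro ⟨k, l, hkl, h, hm⟩
    refine ⟨k.castSucc.castSucc, l.castSucc.castSucc, by simpa using hkl, by simpa using h, ?_⟩
    exact forall_fin_add_two.2 ⟨by simpa using hm, by simp, by simp⟩

/-- The vector whose only entry different from `∞` is the entry `c` in column `k`. -/
def unitRow {n : ℕ} (k : Fin n) (c : ZInf) : Fin n → ZInf :=
  Function.update (fun _ => ⊤) k c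

theorem unitRow_self {n : ℕ} (k : Fin n) (c : ZInf) : unitRow k c k = c := by simp [unitRow]

theorem unitRow_of_ne {n : ℕ} {k i : Fin n} (h : i ≠ k) (c : ZInf) : unitRow k c i = ⊤ := by
  simp [unitRow, h]

theorem le_unitRow_add {n : ℕ} {k : Fin n} {c t : ZInf} {x : Fin n → ZInf} :
    (∀ i, t ≤ unitRow k c i + x i) ↔ t ≤ c + x k := by
  constructor
  · intro h
    simpa [unitRow_self] using h k
  · intro h i
    by_cases hi : i = k
    · subst hi
      simpa [unitRow_self] using h
    · simp [unitRow_of_ne hi]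

/-- Only two columns can have a finite value, so a minimum attained twice makes them agree or be `∞`
together. The row thus acts as an assignment to the additional entry. -/
theorem satisfiesRow_extend_unitRow_zero_top {n : ℕ} (k : Fin n) (c : ZInf) (x : Fin n → ZInf)
    (y z : ZInf) :
    SatisfiesRow (extend (unitRow k c) 0 ⊤) (extend x y z) ↔ c + x k = y := by
  rw [satisfiesRow_iff]
  simp only [exists_fin_add_two, forall_fin_add_two, extend_castSucc_castSucc,
    extend_castSucc_last, extend_last, le_unitRow_add, zero_add, top_add, le_top, and_true]
  constructor
  · rintro (⟨p, ⟨q, hpq, h, h1, h2⟩ | ⟨-, h, h1, -⟩ | ⟨-, h, h1, h2⟩⟩ |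
      ⟨⟨q, hpq, h, h1, h2⟩ | ⟨hne, -⟩ | ⟨-, h, h1, h2⟩⟩ |
      ⟨⟨q, hpq, h, h1, h2⟩ | ⟨-, h, h1, -⟩ | ⟨hne, -⟩⟩)
    · have : unitRow k c q + x q = ⊤ := by
        by_cases hq : q = k
        · subst hq
          rw [← h, unitRow_of_ne (fun e => hpq (by rw [e])), top_add]
        · rw [unitRow_of_ne hq, top_add]
      rw [this, top_le_iff] at h1 h2
      rw [h1, h2]
    · by_cases hp : p = k
      · subst hp
        rwa [unitRow_self] at h
      · rw [unitRow_of_ne hp, top_add] at h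
        rw [← h, top_le_iff] at h1
        rw [h1, h]
    · rw [top_le_iff] at h1 h2
      rw [h1, h2]
    · by_cases hp : q = k
      · subst hp
        rw [unitRow_self] at h
        exact h.symm
      · rw [unitRow_of_ne hp, top_add] at h h1
        rw [top_le_iff] at h1
        rw [h1, h]
    · exact absurd rfl hne
    · rw [top_le_iff] at h1 h2
      rw [h1, h2]
    · rw [← h, top_le_iff] at h1 h2
      rw [h1, h2]
    · rw [← h, top_le_iff] at h1
      rw [h1, h]
    · exact absurd rfl hne
  · intro h
    exact Or.inl ⟨k, Or.inr (Or.inl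
      ⟨by simp [Fin.ext_iff]; omega, by rw [unitRow_self, h], h.ge, le_rfl⟩)⟩

theorem extend_swap {n : ℕ} (u : Fin n → ZInf) (a b : ZInf) (i : Fin (n + 2)) :
    extend u a b (Equiv.swap (Fin.last n).castSucc (Fin.last (n + 1)) i) = extend u b a i := by
  refine forall_fin_add_two (p := fun i =>
    extend u a b (Equiv.swap (Fin.last n).castSucc (Fin.last (n + 1)) i) = extend u b a i) |>.2
    ⟨fun i => ?_, by simp, by simp⟩ i
  rw [Equiv.swap_apply_of_ne_of_ne] <;> simp [Fin.ext_iff] <;> omega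

theorem satisfiesRow_comp_equiv {n : ℕ} (e : Equiv.Perm (Fin n)) {a x : Fin n → ZInf}
    (h : SatisfiesRow a x) : SatisfiesRow (a ∘ e) (x ∘ e) := by
  rw [satisfiesRow_iff] at h ⊢
  obtain ⟨k, l, hkl, h, hm⟩ := h
  exact ⟨e.symm k, e.symm l, by simpa using hkl, by simpa using h, fun i => by
    simpa using hm (e i)⟩

theorem satisfiesRow_extend_swap {n : ℕ} {u x : Fin n → ZInf} {a b y z : ZInf} :
    SatisfiesRow (extend u a b) (extend x y z) ↔ SatisfiesRow (extend u b a) (extend x z y) := by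
  have key : ∀ {a b y z : ZInf}, SatisfiesRow (extend u a b) (extend x y z) →
      SatisfiesRow (extend u b a) (extend x z y) := fun h => by
    simpa [Function.comp_def, extend_swap] using
      satisfiesRow_comp_equiv (Equiv.swap (Fin.last n).castSucc (Fin.last (n + 1))) h
  exact ⟨key, key⟩

theorem satisfiesRow_extend_unitRow_top_zero {n : ℕ} (k : Fin n) (c : ZInf) (x : Fin n → ZInf)
    (y z : ZInf) :
    SatisfiesRow (extend (unitRow k c) ⊤ 0) (extend x y z) ↔ c + x k = z := by
  rw [satisfiesRow_extend_swap, satisfiesRow_extend_unitRow_zero_top]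

/-- The two equal columns supply a double minimum unless column `k` lies strictly below them, and
then it is the only minimiser. This is how inequalities enter a system of equations. -/
theorem satisfiesRow_extend_unitRow_self {n : ℕ} (k : Fin n) (c d : ZInf) (x : Fin n → ZInf)
    (y : ZInf) :
    SatisfiesRow (extend (unitRow k c) d d) (extend x y y) ↔ d + y ≤ c + x k := by
  rw [satisfiesRow_iff]
  constructor
  · rintro ⟨p, q, hpq, h, hm⟩
    by_contra! hlt
    have hfin := hlt.ne_top
    simp only [forall_fin_add_two, extend_castSucc_castSucc, extend_castSucc_last, extend_last,
      le_unitRow_add] at hm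
    have key : ∀ i, extend (unitRow k c) d d i + extend x y y i ≤ c + x k →
        i = k.castSucc.castSucc := by
      refine forall_fin_add_two.2 ⟨fun i hi => ?_, fun hi => ?_, fun hi => ?_⟩
      · by_contra hne
        rw [extend_castSucc_castSucc, unitRow_of_ne (by rintro rfl; exact hne rfl), top_add,
          top_le_iff] at hi
        exact hfin hi
      · simp only [extend_castSucc_last] at hi
        exact absurd hi hlt.not_ge
      · simp only [extend_last] at hi
        exact absurd hi hlt.not_ge
    exact hpq ((key p (h ▸ hm.1)).trans (key q hm.1).symm)
  · intro h
    refine ⟨(Fin.last n).castSucc, Fin.last (n + 1), by simp [Fin.ext_iff], by simp, ?_⟩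
    rw [forall_fin_add_two]
    simp only [extend_castSucc_castSucc, extend_castSucc_last, extend_last, le_unitRow_add]
    exact ⟨h, le_rfl, le_rfl⟩

/-! ### Closing wide gaps in a solution -/

/-- Every finite entry of `a` has absolute value at most `M`. -/
def BoundedBy {n : ℕ} (M : ℤ) (a : Fin n → ZInf) : Prop :=
  ∀ k (z : ℤ), a k = z → |z| ≤ M

open Classical in
/-- The vector `x` with the entries in the columns of `L` raised by one. -/
noncomputable def raise {n : ℕ} (L : Finset (Fin n)) (x : Fin n → ZInf) : Fin n → ZInf :=
  fun k => if k ∈ L then x k + 1 else x k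

theorem le_raise {n : ℕ} (L : Finset (Fin n)) (x : Fin n → ZInf) (k : Fin n) :
    x k ≤ raise L x k := by
  unfold raise
  split_ifs
  · exact le_add_of_nonneg_right zero_le_one
  · exact le_rfl

/-- Raising the entries below a wide gap by one preserves tropical equations with small
coefficients. -/
theorem SatisfiesRow.raise {n : ℕ} {a x : Fin n → ZInf} {M c : ℤ} {L : Finset (Fin n)}
    (h : SatisfiesRow a x) (ha : BoundedBy M a) (hlow : ∀ k ∈ L, x k < c)
    (hhigh : ∀ k ∉ L, ((c + (2 * M + 1) : ℤ) : ZInf) ≤ x k) :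
    SatisfiesRow a (TropicalReduction.raise L x) := by
  rw [satisfiesRow_iff] at h ⊢
  obtain ⟨k, l, hkl, h, hm⟩ := h
  refine ⟨k, l, hkl, ?_⟩
  -- If some `a p` with `p ∈ L` is finite, all minimisers lie in `L`: the values outside are at
  -- least `c + M + 1`, whereas `a p + x p + 1 ≤ c + M`. Both minimisers then rise together and
  -- remain minimal. Otherwise the row does not see the columns of `L`.
  by_cases hp : ∃ p ∈ L, a p ≠ ⊤
  · obtain ⟨p, hpL, hpa⟩ := hp
    obtain ⟨ap, hap⟩ := WithTop.ne_top_iff_exists.1 hpa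
    obtain ⟨xp, hxp⟩ := WithTop.ne_top_iff_exists.1 (hlow p hpL).ne_top
    have h1 := ha p ap hap.symm
    have h2 : xp < c := by
      have := hlow p hpL
      rw [← hxp] at this
      exact_mod_cast this
    have hout : ∀ i ∉ L, a p + x p + 1 < a i + x i := by
      intro i hi
      rw [← hap, ← hxp]
      rcases eq_or_ne (a i) ⊤ with hai | hai
      · rw [hai, top_add]
        exact_mod_cast WithTop.coe_lt_top (ap + xp + 1)
      · obtain ⟨ai, hai⟩ := WithTop.ne_top_iff_exists.1 hai
        have h3 := ha i ai hai.symm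
        refine lt_of_lt_of_le ?_ (add_le_add le_rfl (hhigh i hi))
        rw [← hai]
        have : ap + xp + 1 < ai + (c + (2 * M + 1)) := by
          have := abs_le.1 h1
          have := abs_le.1 h3
          linarith
        exact_mod_cast this
    have hin : ∀ i, a i + x i ≤ a p + x p → i ∈ L := by
      intro i hi
      by_contra hiL
      exact absurd (hout i hiL) (not_lt.2 (hi.trans (le_add_of_nonneg_right zero_le_one)))
    have hl := hin l (hm p)
    have hk := hin k (h ▸ hm p)
    simp only [TropicalReduction.raise, hl, hk, if_true, ← add_assoc, h, true_and]
    intro i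
    split_ifs with hi
    · rw [← add_assoc]
      exact add_le_add (hm i) le_rfl
    · exact (add_le_add (hm p) le_rfl).trans (hout i hi).le
  · push Not at hp
    have key : ∀ i, a i + TropicalReduction.raise L x i = a i + x i := by
      intro i
      by_cases hi : i ∈ L
      · rw [hp i hi, top_add, top_add]
      · simp [TropicalReduction.raise, hi]
    simp only [key]
    exact ⟨h, hm⟩

/-- A solution that strictly prefers column `j` in `l` can be replaced by one whose entries do not
lie far below the entry in column `j`. -/
theorem exists_solution_bounded_below {m n : ℕ} {A : Matrix (Fin m) (Fin n) ZInf}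
    {l : Fin n → ZInf} {M : ℤ} (hM : 0 ≤ M) (hA : ∀ i, BoundedBy M (A i)) {j : Fin n} {v : ℤ} :
    ∀ (N : ℕ) (x : Fin n → ZInf), x j = v → (∑ k, (v - (x k).untopD v).toNat) ≤ N →
      (∀ i, SatisfiesRow (A i) x) → (∀ k ≠ j, l j + x j < l k + x k) →
      ∃ x' : Fin n → ZInf, x' j = v ∧ (∀ i, SatisfiesRow (A i) x') ∧
        (∀ k ≠ j, l j + x' j < l k + x' k) ∧ ∀ k, ((v - n * (2 * M + 1) : ℤ) : ZInf) ≤ x' k := by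
  classical
  intro N
  -- `N` bounds the total deficit of the entries below `v`, and each raise lowers this total. The
  -- default of `untopD` lets an entry `∞` count as `v`, hence as no deficit.
  induction N with
  | zero =>
    intro x hj hN hx hl
    refine ⟨x, hj, hx, hl, fun k => ?_⟩
    rcases eq_or_ne (x k) ⊤ with hk | hk
    · simp [hk]
    · obtain ⟨xk, hk⟩ := WithTop.ne_top_iff_exists.1 hk
      have h1 := Finset.sum_eq_zero_iff.1 (Nat.le_zero.1 hN) k (Finset.mem_univ k)
      rw [← hk, WithTop.untopD_coe] at h1
      rw [← hk]
      have : (0 : ℤ) ≤ n * (2 * M + 1) := by positivity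
      have : v - n * (2 * M + 1) ≤ xk := by omega
      exact_mod_cast this
  | succ N ih =>
    intro x hj hN hx hl
    let L : ℕ → Finset (Fin n) := fun d =>
      Finset.univ.filter fun k => x k < ((v - d * (2 * M + 1) : ℤ) : ZInf)
    have hLmem : ∀ d k, k ∈ L d ↔ x k < ((v - d * (2 * M + 1) : ℤ) : ZInf) :=
      fun d k => by simp only [L, Finset.mem_filter, Finset.mem_univ, true_and]
    have hanti : ∀ d, L (d + 1) ⊆ L d := by
      intro d k hk
      rw [hLmem] at hk ⊢
      refine hk.trans_le ?_
      have : v - ((d + 1 : ℕ) : ℤ) * (2 * M + 1) ≤ v - d * (2 * M + 1) := by push_cast; nlinarith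
      exact_mod_cast this
    -- `L (d + 1) = L d` says that no entry lies in a certain window of width `2 * M + 1`. The
    -- entries below the window can be raised; `x j` lies above it, so the strict inequalities for
    -- `l` survive.
    by_cases hgap : ∃ d, L (d + 1) = L d ∧ (L d).Nonempty
    · obtain ⟨d, hd, hne⟩ := hgap
      have hjL : j ∉ L d := by
        rw [hLmem, hj, not_lt]
        have : v - d * (2 * M + 1) ≤ v := by
          have : (0 : ℤ) ≤ d * (2 * M + 1) := by positivity
          linarith
        exact_mod_cast this
      have hrj : raise (L d) x j = x j := by simp [raise, hjL]
      refine ih (raise (L d) x) (hrj.trans hj) ?_ (fun i => ?_) (fun k hk => ?_)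
      · have hlt : ∑ k, (v - (raise (L d) x k).untopD v).toNat <
            ∑ k, (v - (x k).untopD v).toNat := by
          have hdec : ∀ k ∈ L d, (v - (raise (L d) x k).untopD v).toNat <
              (v - (x k).untopD v).toNat := by
            intro k hk
            have h1 := (hLmem d k).1 hk
            obtain ⟨xk, hxk⟩ := WithTop.ne_top_iff_exists.1 h1.ne_top
            have h2 : raise (L d) x k = ((xk + 1 : ℤ) : ZInf) := by
              simp [raise, hk, ← hxk]
            rw [← hxk] at h1
            rw [h2, ← hxk, WithTop.untopD_coe, WithTop.untopD_coe]
            have h3 : xk < v - d * (2 * M + 1) := by exact_mod_cast h1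
            have : (0 : ℤ) ≤ d * (2 * M + 1) := by positivity
            omega
          refine Finset.sum_lt_sum (fun k _ => ?_) ?_
          · by_cases hk : k ∈ L d
            · exact (hdec k hk).le
            · simp [raise, hk]
          · obtain ⟨k, hk⟩ := hne
            exact ⟨k, Finset.mem_univ k, hdec k hk⟩
        omega
      · refine (hx i).raise (c := v - (d + 1 : ℕ) * (2 * M + 1)) (hA i) (fun k hk => ?_)
          (fun k hk => ?_)
        · rw [← hd, hLmem] at hk
          exact hk
        · rw [hLmem, not_lt] at hk
          convert hk using 2
          push_cast
          ring
      · rw [hrj]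
        exact (hl k hk).trans_le (add_le_add le_rfl (le_raise _ _ _))
    · push Not at hgap
      -- Without such a gap the sets shrink strictly until they are empty, so at most `n` windows
      -- are needed.
      have hcard : ∀ d, L d = ∅ ∨ (L d).card + d ≤ n := by
        intro d
        induction d with
        | zero => exact Or.inr (by simpa using Finset.card_le_univ (L 0))
        | succ d ih =>
          by_cases he : L d = ∅
          · exact Or.inl (Finset.subset_empty.1 (he ▸ hanti d))
          · right
            have h1 : L (d + 1) ⊂ L d :=
              (hanti d).ssubset_of_ne fun e => he (hgap d e)
            have := Finset.card_lt_card h1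
            have := ih.resolve_left he
            omega
      have hempty : L n = ∅ := by
        rcases hcard n with h | h
        · exact h
        · exact Finset.card_eq_zero.1 (by omega)
      refine ⟨x, hj, hx, hl, fun k => not_lt.1 fun hk => ?_⟩
      have := (hLmem n k).2 hk
      simp [hempty] at this

/-! ### Non-implication as solvability of one system per column -/

/-- The systems whose solvability is asked about: `x` is a solution of `A`, and its entry in column
`j` is finite and the strict minimum of the equation `l`. -/
theorem not_implies_iff {m n : ℕ} (hn : 2 ≤ n) {A : Matrix (Fin m) (Fin n) ZInf}
    {l : Fin n → ZInf} {M C : ℤ} (hM : 0 ≤ M) (hA : ∀ i, BoundedBy M (A i)) (hl : BoundedBy M l)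
    (hC : n * (2 * M + 1) + M + 1 ≤ C) :
    ¬ Implies A l ↔ ∃ (j : Fin n) (x : Fin n → ZInf), IsSolution A x ∧
      (∀ k, l j + (1 + x j) ≤ C + x k) ∧ ∀ k ≠ j, l j + (1 + x j) ≤ l k + x k := by
  classical
  simp only [Implies, not_forall, exists_prop]
  constructor
  · rintro ⟨x, ⟨-, hx⟩, hxl⟩
    have : Nonempty (Fin n) := ⟨⟨0, by omega⟩⟩
    obtain ⟨j, hj⟩ := Finite.exists_min fun k => l k + x k
    have hlt : ∀ k ≠ j, l j + x j < l k + x k := fun k hk =>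
      lt_of_le_of_ne (hj k) fun e => hxl (satisfiesRow_iff.2 ⟨k, j, hk, e.symm, hj⟩)
    have hfin : l j + x j ≠ ⊤ := by
      have : Nontrivial (Fin n) := Fin.nontrivial_iff_two_le.2 hn
      obtain ⟨k, hk⟩ := exists_ne j
      exact (hlt k hk).ne_top
    rw [WithTop.add_ne_top] at hfin
    obtain ⟨lj, hlj⟩ := WithTop.ne_top_iff_exists.1 hfin.1
    obtain ⟨v, hv⟩ := WithTop.ne_top_iff_exists.1 hfin.2
    obtain ⟨x', h1, h2, h3, h4⟩ := exists_solution_bounded_below hM hA _ x hv.symm le_rfl hx hlt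
    have hb := abs_le.1 (hl j lj hlj.symm)
    refine ⟨j, x', ⟨fun e => ?_, h2⟩, fun k => ?_, fun k hk => ?_⟩
    · rw [e] at h1
      exact WithTop.top_ne_coe h1
    -- Here `C` has to absorb `l j ≤ M`, the added one, and the depth `n * (2 * M + 1)` of the
    -- entries.
    · refine le_trans ?_ (add_le_add le_rfl (h4 k))
      rw [h1, ← hlj]
      have : lj + (1 + v) ≤ C + (v - n * (2 * M + 1)) := by linarith
      exact_mod_cast this
    · have h5 := h3 k hk
      rw [h1, ← hlj] at h5 ⊢
      rcases eq_or_ne (l k + x' k) ⊤ with ht | ht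
      · rw [ht]
        exact le_top
      · obtain ⟨t, ht⟩ := WithTop.ne_top_iff_exists.1 ht
        rw [← ht] at h5 ⊢
        have h6 : lj + v < t := by exact_mod_cast h5
        have : lj + (1 + v) ≤ t := by omega
        exact_mod_cast this
  · rintro ⟨j, x, hx, hCx, hlx⟩
    refine ⟨x, hx, ?_⟩
    -- The bounds with `C` exist for this: at a column `k` where `x k` is finite, `C + x k` is
    -- finite.
    have hfin : l j + (1 + x j) ≠ ⊤ := by
      obtain ⟨k, hk⟩ := Function.ne_iff.1 hx.1
      exact ne_top_of_le_ne_top (WithTop.add_ne_top.2 ⟨WithTop.coe_ne_top, hk⟩) (hCx k)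
    have hlt : ∀ k ≠ j, l j + x j < l k + x k := by
      intro k hk
      refine lt_of_lt_of_le ?_ (hlx k hk)
      rw [WithTop.add_ne_top, WithTop.add_ne_top] at hfin
      obtain ⟨lj, hlj⟩ := WithTop.ne_top_iff_exists.1 hfin.1
      obtain ⟨v, hv⟩ := WithTop.ne_top_iff_exists.1 hfin.2.2
      rw [← hlj, ← hv]
      have : lj + v < lj + (1 + v) := by omega
      exact_mod_cast this
    rw [satisfiesRow_iff]
    rintro ⟨k, k', hne, he, hmin⟩
    have key : ∀ i, l i + x i = l k' + x k' → i = j := by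
      intro i hi
      by_contra hij
      exact absurd (hmin j) (not_le.2 (hi ▸ hlt i hij))
    exact hne ((key k he).trans (key k' rfl).symm)

/-- The rows of the query that belongs to column `j`. -/
def queryRows {m n : ℕ} (A : Matrix (Fin m) (Fin n) ZInf) (l : Fin n → ZInf) (C : ℤ) (j : Fin n) :
    Set (Fin (n + 2) → ZInf) :=
  {r | r = extend (unitRow j 1) 0 ⊤ ∨ r = extend (unitRow j 1) ⊤ 0 ∨
    (∃ i, r = extend (A i) ⊤ ⊤) ∨ (∃ k, r = extend (unitRow k C) (l j) (l j)) ∨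
    ∃ k, r = extend (unitRow k (Function.update l j ⊤ k)) (l j) (l j)}

/-- The first two rows determine the additional entries, so a solution of the query carries the same
information as `x`. In the last family of rows the coefficient of column `j` is `∞`, which makes
that row vacuous and lets the family run over all columns. -/
theorem exists_satisfies_queryRows_iff {m n : ℕ} (hn : 2 ≤ n) {A : Matrix (Fin m) (Fin n) ZInf}
    {l : Fin n → ZInf} {C : ℤ} {j : Fin n} :
    (∃ X : Fin (n + 2) → ZInf, X ≠ (fun _ => ⊤) ∧ ∀ r ∈ queryRows A l C j, SatisfiesRow r X) ↔
      ∃ x : Fin n → ZInf, IsSolution A x ∧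
      (∀ k, l j + (1 + x j) ≤ C + x k) ∧ ∀ k ≠ j, l j + (1 + x j) ≤ l k + x k := by
  constructor
  · rintro ⟨X, hX, h⟩
    obtain ⟨x, y, z, rfl⟩ := exists_extend X
    obtain rfl := (satisfiesRow_extend_unitRow_zero_top j 1 x y z).1 (h _ (by simp [queryRows]))
    obtain rfl := (satisfiesRow_extend_unitRow_top_zero j 1 x _ z).1 (h _ (by simp [queryRows]))
    refine ⟨x, ⟨?_, fun i => ?_⟩, fun k => ?_, fun k hk => ?_⟩
    · rintro rfl
      exact hX (extend_eq_top.2 ⟨rfl, by simp⟩)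
    · exact (satisfiesRow_extend_top hn _ _ _ _).1
        (h _ (Or.inr (Or.inr (Or.inl ⟨i, rfl⟩))))
    · exact (satisfiesRow_extend_unitRow_self _ _ _ _ _).1
        (h _ (Or.inr (Or.inr (Or.inr (Or.inl ⟨k, rfl⟩)))))
    · simpa [hk] using (satisfiesRow_extend_unitRow_self _ _ _ _ _).1
        (h _ (Or.inr (Or.inr (Or.inr (Or.inr ⟨k, rfl⟩)))))
  · rintro ⟨x, hx, h1, h2⟩
    refine ⟨extend x (1 + x j) (1 + x j), fun e => hx.1 (extend_eq_top.1 e).1, ?_⟩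
    rintro r (rfl | rfl | ⟨i, rfl⟩ | ⟨k, rfl⟩ | ⟨k, rfl⟩)
    · exact (satisfiesRow_extend_unitRow_zero_top j 1 x _ _).2 rfl
    · exact (satisfiesRow_extend_unitRow_top_zero j 1 x _ _).2 rfl
    · exact (satisfiesRow_extend_top hn _ _ _ _).2 (hx.2 i)
    · exact (satisfiesRow_extend_unitRow_self _ _ _ _ _).2 (h1 k)
    · rw [satisfiesRow_extend_unitRow_self]
      by_cases hk : k = j
      · subst hk
        simp
      · simpa [hk] using h2 k hk

theorem implies_iff {m n : ℕ} (hn : 2 ≤ n) {A : Matrix (Fin m) (Fin n) ZInf}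
    {l : Fin n → ZInf} {M C : ℤ} (hM : 0 ≤ M) (hA : ∀ i, BoundedBy M (A i)) (hl : BoundedBy M l)
    (hC : n * (2 * M + 1) + M + 1 ≤ C) :
    Implies A l ↔ ∀ j, ¬ ∃ X : Fin (n + 2) → ZInf, X ≠ (fun _ => ⊤) ∧
      ∀ r ∈ queryRows A l C j, SatisfiesRow r X := by
  rw [← not_iff_not, not_implies_iff hn hM hA hl hC]
  simp only [exists_satisfies_queryRows_iff hn, not_forall, not_not]

theorem implies_of_eq_zero {m : ℕ} (A : Matrix (Fin m) (Fin 0) ZInf) (l : Fin 0 → ZInf) :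
    Implies A l := fun _ hx => absurd (funext fun k => k.elim0) hx.1

theorem not_satisfiesRow_one (a x : Fin 1 → ZInf) : ¬ SatisfiesRow a x := by
  rintro ⟨k, l, h, -⟩
  omega

/-- Fewer than two columns need separate treatment. With one column no row can be satisfied, so
every row makes `A` unsolvable, while without rows the vector `0` is a solution that violates `l`.
-/
theorem implies_one_iff {m : ℕ} (A : Matrix (Fin m) (Fin 1) ZInf) (l : Fin 1 → ZInf) :
    Implies A l ↔ m ≠ 0 := by
  constructor
  · rintro h rfl
    exact not_satisfiesRow_one _ _ (h (fun _ => 0)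
      ⟨fun e => by simpa using congrFun e 0, fun i => i.elim0⟩)
  · intro hm x hx
    exact absurd (hx.2 ⟨0, by omega⟩) (not_satisfiesRow_one _ _)

/-! ### Lengths of encodings and sizes of coefficients -/

theorem cast_lt_two_pow_length_encodePosNum (p : PosNum) :
    (p : ℕ) < 2 ^ (Computability.encodePosNum p).length := by
  induction p with
  | one => simp [Computability.encodePosNum]
  | bit0 p ih =>
    simp only [Computability.encodePosNum, List.length_cons, pow_succ, PosNum.cast_bit0]
    omega
  | bit1 p ih =>
    simp only [Computability.encodePosNum, List.length_cons, pow_succ, PosNum.cast_bit1]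
    omega

theorem lt_two_pow_length_encodeNat (n : ℕ) : n < 2 ^ (Computability.encodeNat n).length := by
  have h : ((n : Num) : ℕ) = n := Num.to_of_nat n
  unfold Computability.encodeNat
  rcases hp : (n : Num) with _ | p
  · rw [hp] at h
    simp at h
    simp [← h]
  · rw [hp] at h
    conv_lhs => rw [← h]
    exact cast_lt_two_pow_length_encodePosNum p

theorem natAbs_lt_two_pow_length (z : ℤ) : z.natAbs < 2 ^ (encodeInt z).length := by
  refine (lt_two_pow_length_encodeNat z.natAbs).trans_le (Nat.pow_le_pow_right two_pos ?_)
  simp [encodeInt]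

/-- The constant in the queries has this form so that it can be written without arithmetic, one
digit for each symbol of the input. -/
theorem encodeNat_two_pow_sub_one (W : ℕ) :
    Computability.encodeNat (2 ^ W - 1) = List.replicate W true := by
  have key : ∀ W : ℕ, ∃ p : PosNum, Computability.encodePosNum p = List.replicate (W + 1) true ∧
      (p : ℕ) + 1 = 2 ^ (W + 1) := by
    intro W
    induction W with
    | zero => exact ⟨PosNum.one, by simp [Computability.encodePosNum], by simp⟩
    | succ W ih =>
      obtain ⟨p, h1, h2⟩ := ih
      refine ⟨PosNum.bit1 p, by simp [Computability.encodePosNum, h1, List.replicate_succ], ?_⟩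
      rw [PosNum.cast_bit1, pow_succ, ← h2]
      ring
  cases W with
  | zero => rfl
  | succ W =>
    obtain ⟨p, h1, h2⟩ := key W
    have h3 : ((2 ^ (W + 1) - 1 : ℕ) : Num) = Num.pos p := by
      rw [← h2, Nat.add_sub_cancel]
      exact_mod_cast Num.of_to_nat (Num.pos p)
    rw [Computability.encodeNat, h3]
    exact h1

theorem encodeEntry_two_pow_sub_one (W : ℕ) :
    encodeEntry ((2 ^ W - 1 : ℤ) : ZInf) = List.replicate W (Symbol.bit true) := by
  have h0 : ((2 ^ W - 1 : ℕ) : ℤ) = 2 ^ W - 1 := by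
    rw [Nat.cast_sub Nat.one_le_two_pow]
    simp
  change encodeInt (2 ^ W - 1) = _
  rw [← h0, encodeInt, if_neg (by omega), Int.natAbs_natCast, encodeNat_two_pow_sub_one]
  simp

theorem encodeEntry_zero : encodeEntry (0 : ZInf) = [] := by
  change encodeInt 0 = []
  simp [encodeInt, Computability.encodeNat, Computability.encodeNum]

theorem encodeEntry_one : encodeEntry (1 : ZInf) = [Symbol.bit true] := by
  have := encodeEntry_two_pow_sub_one 1
  norm_num at this
  simpa using this

theorem encodeEntry_top : encodeEntry (⊤ : ZInf) = [Symbol.infty] := rfl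

/-- Notation of a list of entries, each followed by a comma. -/
def encodeList (v : List ZInf) : List Symbol :=
  v.flatMap fun a => encodeEntry a ++ [Symbol.comma]

/-- Notation of a list of rows, each followed by a semicolon. -/
def encodeRows (rows : List (List ZInf)) : List Symbol :=
  rows.flatMap fun r => encodeList r ++ [Symbol.semicolon]

theorem encodeVector_eq {n : ℕ} (v : Fin n → ZInf) : encodeVector v = encodeList (List.ofFn v) :=
  rfl

theorem encodeMatrix_eq {m n : ℕ} (A : Matrix (Fin m) (Fin n) ZInf) :
    encodeMatrix A = (List.replicate n (Symbol.bit true) ++ [Symbol.semicolon]) ++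
      encodeRows ((List.ofFn A).map List.ofFn) := by
  simp only [encodeMatrix, encodeRows, List.flatMap_map]
  rfl

/-- A word determines its instance by injectivity of the encoding. Solvability depends only on the
set of rows, so a query may list them in any order and with repetitions. -/
theorem encodeRows_mem_language {n : ℕ} (rows : List (Fin n → ZInf)) :
    ((List.replicate n (Symbol.bit true) ++ [Symbol.semicolon]) ++
      encodeRows (rows.map List.ofFn)) ∈ TropSolvInf.language ↔
      ∃ X : Fin n → ZInf, X ≠ (fun _ => ⊤) ∧ ∀ r ∈ rows, SatisfiesRow r X := by
  have h : (List.replicate n (Symbol.bit true) ++ [Symbol.semicolon]) ++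
      encodeRows (rows.map List.ofFn) =
      TropSolvInf.encode (⟨rows.length, n, rows.get⟩ : SolvInstance) := by
    change _ = encodeMatrix _
    rw [encodeMatrix_eq, List.ofFn_get]
  have h2 : (∃ X : Fin n → ZInf, X ≠ (fun _ => ⊤) ∧ ∀ r ∈ rows, SatisfiesRow r X) ↔
      TropSolvInf.IsYes (⟨rows.length, n, rows.get⟩ : SolvInstance) := by
    change _ ↔ Solvable (fun i => rows.get i)
    simp only [Solvable, IsSolution, List.forall_mem_iff_get]
  rw [h, h2]
  constructor
  · rintro ⟨a, ha, hy⟩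
    rwa [← TropSolvInf.encode_injective ha]
  · exact fun hy => ⟨_, rfl, hy⟩

theorem ofFn_extend {n : ℕ} (u : Fin n → ZInf) (a b : ZInf) :
    List.ofFn (extend u a b) = List.ofFn u ++ [a, b] := by
  rw [extend, List.ofFn_succ_last, List.ofFn_succ_last]
  simp

theorem ofFn_unitRow {n : ℕ} (k : Fin n) (c : ZInf) :
    List.ofFn (unitRow k c) =
      List.replicate k ⊤ ++ c :: List.replicate (n - 1 - k) ⊤ := by
  refine List.ext_getElem (by simp; omega) fun i h1 h2 => ?_
  rw [List.getElem_ofFn, List.getElem_append]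
  split_ifs with h
  · rw [unitRow_of_ne (by simp at h; simp [Fin.ext_iff]; omega)]
    simp
  · rw [List.length_replicate] at h
    simp only [List.length_replicate]
    rcases Nat.eq_or_lt_of_le (not_lt.1 h) with h' | h'
    · subst h'
      simp [unitRow_self]
    · rw [List.getElem_cons, dif_neg (by omega), List.getElem_replicate,
        unitRow_of_ne (by simp [Fin.ext_iff]; omega)]

theorem length_encodeEntry_le {v : List ZInf} {a : ZInf} (h : a ∈ v) :
    (encodeEntry a).length + v.length ≤ (encodeList v).length := by
  induction v with
  | nil => simp at h
  | cons b v ih =>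
    have hv : v.length ≤ (encodeList v).length := by
      simp only [encodeList, List.length_flatMap, List.length_append, List.length_singleton]
      simp
    have hc : (encodeList (b :: v)).length =
        (encodeEntry b).length + 1 + (encodeList v).length := by
      simp [encodeList]
      omega
    rw [hc, List.length_cons]
    rcases List.mem_cons.1 h with rfl | h
    · omega
    · have := ih h
      omega

theorem boundedBy_of_length_le {n B : ℕ} (a : Fin n → ZInf)
    (h : (encodeVector a).length ≤ B + n) : BoundedBy (2 ^ B) a := by
  intro k z hz
  have h1 := length_encodeEntry_le (v := List.ofFn a) (a := a k) (by simp)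
  rw [← encodeVector_eq, List.length_ofFn, hz] at h1
  have h2 : (encodeEntry (z : ZInf)).length = (encodeInt z).length := rfl
  have h3 := natAbs_lt_two_pow_length z
  have h4 : 2 ^ (encodeInt z).length ≤ 2 ^ B := Nat.pow_le_pow_right two_pos (by omega)
  rw [Int.abs_eq_natAbs]
  exact_mod_cast h3.le.trans h4

theorem length_encodeVector_row_le {m n : ℕ} (A : Matrix (Fin m) (Fin n) ZInf) (i : Fin m) :
    (encodeVector (A i)).length + n + 1 ≤ (encodeMatrix A).length := by
  have h : (encodeVector (A i)).length ≤
      ((List.ofFn fun i => A i).flatMap fun r => encodeVector r ++ [Symbol.semicolon]).length := by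
    rw [List.length_flatMap]
    refine le_trans ?_ (List.le_sum_of_mem
      (x := (encodeVector (A i) ++ [Symbol.semicolon]).length) ?_)
    · simp
    · exact List.mem_map.2 ⟨A i, List.mem_ofFn.2 ⟨i, rfl⟩, rfl⟩
  simp only [encodeMatrix, List.length_append, List.length_replicate, List.length_singleton]
  omega

theorem le_length_encodeVector {n : ℕ} (a : Fin n → ZInf) : n ≤ (encodeVector a).length := by
  rcases Nat.eq_zero_or_pos n with h | h
  · omega
  · have := length_encodeEntry_le (v := List.ofFn a) (a := a ⟨0, h⟩) (by simp)
    rw [List.length_ofFn] at this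
    rw [encodeVector_eq]
    omega

/-- The implication instance in terms of the words that the reduction sends to the oracle. -/
theorem implies_iff_notMem_language {m n : ℕ} (hn : 2 ≤ n) (A : Matrix (Fin m) (Fin n) ZInf)
    (l : Fin n → ZInf) {W : ℕ}
    (hW : W = (encodeVector l ++ Symbol.semicolon :: encodeMatrix A).length)
    (rows : Fin n → List (Fin (n + 2) → ZInf))
    (hrows : ∀ j r, r ∈ rows j ↔ r ∈ queryRows A l (2 ^ W - 1) j) :
    Implies A l ↔ ∀ j, ((List.replicate (n + 2) (Symbol.bit true) ++ [Symbol.semicolon]) ++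
      encodeRows ((rows j).map List.ofFn)) ∉ TropSolvInf.language := by
  rw [List.length_append, List.length_cons] at hW
  have hl := le_length_encodeVector l
  have hA : n + 1 ≤ (encodeMatrix A).length := by
    simp only [encodeMatrix, List.length_append, List.length_replicate, List.length_singleton]
    omega
  -- The `2 * n + 2` symbols set aside are the `n` unary digits, the `n` commas of `l` and two
  -- semicolons. No entry is longer than the remaining `B`.
  obtain ⟨B, hB⟩ : ∃ B, W = B + 2 * n + 2 := ⟨W - (2 * n + 2), by omega⟩
  have hA' : ∀ i, BoundedBy (2 ^ B) (A i) := fun i => by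
    refine boundedBy_of_length_le _ ?_
    have := length_encodeVector_row_le A i
    omega
  rw [implies_iff hn (M := 2 ^ B) (C := 2 ^ W - 1) (by positivity) hA'
    (boundedBy_of_length_le _ (by omega)) ?_]
  · refine forall_congr' fun j => not_congr ?_
    rw [encodeRows_mem_language]
    simp only [hrows]
  -- `2 ^ W` is at least `4 * 2 ^ B * (n + 1) ^ 2`, which dominates the required bound with `M = 2 ^
  -- B`.
  · have h1 : (n : ℤ) + 1 ≤ 2 ^ n := by exact_mod_cast Nat.lt_two_pow_self (n := n)
    have h2 : (1 : ℤ) ≤ 2 ^ B := one_le_pow₀ (by norm_num)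
    have h3 : (2 : ℤ) ^ W = 2 ^ B * (2 ^ n * 2 ^ n) * 4 := by
      rw [hB]
      ring
    have h4 : ((n : ℤ) + 1) * (n + 1) ≤ 2 ^ n * 2 ^ n :=
      mul_le_mul h1 h1 (by positivity) (by positivity)
    have h5 : (2 : ℤ) ^ B * ((n + 1) * (n + 1)) ≤ 2 ^ B * (2 ^ n * 2 ^ n) :=
      mul_le_mul_of_nonneg_left h4 (by positivity)
    have h6 : (0 : ℤ) ≤ n := by positivity
    rw [h3]
    nlinarith [mul_nonneg h6 (sub_nonneg.2 h2), mul_nonneg (mul_nonneg h6 h6) (sub_nonneg.2 h2)]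

/-! ## A small programming language for oracle machines -/

namespace OracleMachine

/-- `M` gets from `c` to `c'` in at most `t` steps. -/
inductive Reaches (M : OracleMachine) (O : Set (List Symbol)) : ℕ → M.Cfg → M.Cfg → Prop
  | refl (c : M.Cfg) : Reaches M O 0 c c
  | head {t : ℕ} {c d e : M.Cfg} : M.step O c = some d → Reaches M O t d e →
      Reaches M O (t + 1) c e
  | mono {t t' : ℕ} {c d : M.Cfg} : Reaches M O t c d → t ≤ t' → Reaches M O t' c d

variable {M : OracleMachine} {O : Set (List Symbol)}

theorem Reaches.trans {s t : ℕ} {c d e : M.Cfg} (h : M.Reaches O s c d) (h' : M.Reaches O t d e) :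
    M.Reaches O (s + t) c e := by
  induction h with
  | refl => simpa using h'
  | head h1 _ ih => exact ((ih h').head h1).mono (by omega)
  | mono _ h2 ih => exact (ih h').mono (by omega)

theorem Reaches.single {c d : M.Cfg} (h : M.step O c = some d) : M.Reaches O 1 c d :=
  (Reaches.refl d).head h

theorem Reaches.exists_run {w : List Symbol} {t : ℕ} {c d : M.Cfg} (h : M.Reaches O t c d) :
    ∀ {s : ℕ}, M.run O w s = some c → ∃ u ≤ s + t, M.run O w u = some d := by
  induction h with
  | refl => exact fun hs => ⟨_, le_rfl, hs⟩
  | head h1 _ ih =>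
    intro s hs
    obtain ⟨u, hu, hd⟩ := ih (s := s + 1) (by rw [run, hs, Option.bind_some, h1])
    exact ⟨u, by omega, hd⟩
  | mono _ h2 ih =>
    intro s hs
    obtain ⟨u, hu, hd⟩ := ih hs
    exact ⟨u, by omega, hd⟩

end OracleMachine

/-- The contents of the stacks. -/
abbrev Stacks (K : Type) : Type := K → List Symbol

/-- Structured programs that work on stacks and a Boolean verdict. -/
inductive Prog (K : Type)
  /-- push symbols in the given order -/
  | pushes (l : List (K × Symbol))
  /-- pop symbols, performing the pushes `f s` for each symbol `s`, until the stack is empty or a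
  symbol that satisfies `last` has been popped -/
  | drain (X : K) (last : Symbol → Bool) (f : Symbol → List (K × Symbol))
  | seq (p q : Prog K)
  /-- repeat `p` while the stack is nonempty -/
  | whileNonempty (X : K) (p : Prog K)
  | ifEmpty (X : K) (p q : Prog K)
  /-- query the oracle, and turn the verdict to `false` if the answer is affirmative -/
  | query
  /-- turn the verdict to `false` -/
  | reject

/-- The stacks after a list of pushes. -/
def pushAll {K : Type} [DecidableEq K] (l : List (K × Symbol)) (S : Stacks K) : Stacks K :=
  l.foldl (fun S a => Function.update S a.1 (a.2 :: S a.1)) S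

namespace Prog

open Classical in
/-- `Exec O q p b S b' S' t`: with the oracle `O` and the query stack `q`, the program `p` leads
from the verdict `b` and the stacks `S` to `b'` and `S'` in at most `t` steps. -/
inductive Exec {K : Type} [DecidableEq K] (O : Set (List Symbol)) (q : K) :
    Prog K → Bool → Stacks K → Bool → Stacks K → ℕ → Prop
  | pushes (l b S) : Exec O q (.pushes l) b S b (pushAll l S) 1
  | drain_nil {X last f b S} : S X = [] → Exec O q (.drain X last f) b S b S 1
  | drain_found {X last f b S s r} : S X = s :: r → last s = true →
      Exec O q (.drain X last f) b S b (Function.update S X r) 1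
  | drain_cons {X last f b S s r b' S' t} : S X = s :: r → last s = false →
      Exec O q (.drain X last f) b (pushAll (f s) (Function.update S X r)) b' S' t →
      Exec O q (.drain X last f) b S b' S' (t + 2)
  | seq {p p' b S b₁ S₁ b₂ S₂ t t'} : Exec O q p b S b₁ S₁ t → Exec O q p' b₁ S₁ b₂ S₂ t' →
      Exec O q (.seq p p') b S b₂ S₂ (t + t')
  | while_nil {X p b S} : S X = [] → Exec O q (.whileNonempty X p) b S b S 1
  | while_cons {X p b S b₁ S₁ b₂ S₂ t t'} : S X ≠ [] → Exec O q p b S b₁ S₁ t →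
      Exec O q (.whileNonempty X p) b₁ S₁ b₂ S₂ t' →
      Exec O q (.whileNonempty X p) b S b₂ S₂ (1 + t + t')
  | ifEmpty_nil {X p p' b S b' S' t} : S X = [] → Exec O q p b S b' S' t →
      Exec O q (.ifEmpty X p p') b S b' S' (t + 1)
  | ifEmpty_cons {X p p' b S b' S' t} : S X ≠ [] → Exec O q p' b S b' S' t →
      Exec O q (.ifEmpty X p p') b S b' S' (t + 1)
  | query (b S) : Exec O q .query b S (b && !decide (S q ∈ O)) (Function.update S q []) 2
  | reject (b S) : Exec O q .reject b S false S 1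
  | mono {p b S b' S' t t'} : Exec O q p b S b' S' t → t ≤ t' → Exec O q p b S b' S' t'

/-! ### Compilation of programs to oracle machines -/

/-- The labels of the compiled program. -/
def Lab {K : Type} : Prog K → Type
  | .pushes _ => Unit
  | .drain _ _ _ => Option Symbol
  | .seq p q => p.Lab ⊕ q.Lab
  | .whileNonempty _ p => Option p.Lab
  | .ifEmpty _ p q => Option (p.Lab ⊕ q.Lab)
  | .query => Option Bool
  | .reject => Unit

theorem finite_lab {K : Type} : ∀ p : Prog K, Finite p.Lab
  | .pushes _ => inferInstanceAs (Finite Unit)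
  | .drain _ _ _ => inferInstanceAs (Finite (Option Symbol))
  | .seq p q =>
    have := finite_lab p
    have := finite_lab q
    inferInstanceAs (Finite (p.Lab ⊕ q.Lab))
  | .whileNonempty _ p =>
    have := finite_lab p
    inferInstanceAs (Finite (Option p.Lab))
  | .ifEmpty _ p q =>
    have := finite_lab p
    have := finite_lab q
    inferInstanceAs (Finite (Option (p.Lab ⊕ q.Lab)))
  | .query => inferInstanceAs (Finite (Option Bool))
  | .reject => inferInstanceAs (Finite Unit)

/-- The label at which the compiled program starts. -/
def start {K : Type} : (p : Prog K) → p.Lab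
  | .pushes _ => ()
  | .drain _ _ _ => (none : Option Symbol)
  | .seq p q => (Sum.inl p.start : p.Lab ⊕ q.Lab)
  | .whileNonempty _ p => (none : Option p.Lab)
  | .ifEmpty _ p q => (none : Option (p.Lab ⊕ q.Lab))
  | .query => (none : Option Bool)
  | .reject => ()

/-- The internal states of compiled programs: a register for a symbol, and the verdict. -/
abbrev Reg : Type := Option Symbol × Bool

/-- The instructions of compiled programs. -/
abbrev Instr (K Λ : Type) : Type := Turing.TM2.Stmt (fun _ : K => Symbol) Λ Reg ⊕ (Bool → Λ)

/-- The statement that performs pushes and then jumps. -/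
def pushStmt {K Λ : Type} (l : List (K × Symbol)) (exit : Λ) :
    Turing.TM2.Stmt (fun _ : K => Symbol) Λ Reg :=
  l.foldr (fun a s => .push a.1 (fun _ => a.2) s) (.goto fun _ => exit)

/-- The compiled program, with labels embedded by `emb`, that jumps to `exit` at the end. -/
def code {K Λ : Type} : (p : Prog K) → (p.Lab → Λ) → Λ → p.Lab → Instr K Λ
  | .pushes l, _, exit => fun _ => .inl (pushStmt l exit)
  | .drain X last f, emb, exit => fun
    | none => .inl (.pop X (fun v s => (s, v.2)) (.goto fun v => match v.1 with
      | none => exit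
      | some s => bif last s then exit else emb (some s : Option Symbol)))
    | some s => .inl (pushStmt (f s) (emb (none : Option Symbol)))
  | .seq p q, emb, exit => fun
    | .inl x => p.code (fun y => emb (.inl y : p.Lab ⊕ q.Lab))
      (emb (.inr q.start : p.Lab ⊕ q.Lab)) x
    | .inr x => q.code (fun y => emb (.inr y : p.Lab ⊕ q.Lab)) exit x
  | .whileNonempty X p, emb, exit => fun
    | none => .inl (.peek X (fun v s => (s, v.2)) (.goto fun v => match v.1 with
      | none => exit
      | some _ => emb (some p.start : Option p.Lab)))
    | some x => p.code (fun y => emb (some y : Option p.Lab)) (emb (none : Option p.Lab)) x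
  | .ifEmpty X p q, emb, exit => fun
    | none => .inl (.peek X (fun v s => (s, v.2)) (.goto fun v => match v.1 with
      | none => emb (some (.inl p.start) : Option (p.Lab ⊕ q.Lab))
      | some _ => emb (some (.inr q.start) : Option (p.Lab ⊕ q.Lab))))
    | some (.inl x) => p.code (fun y => emb (some (.inl y) : Option (p.Lab ⊕ q.Lab))) exit x
    | some (.inr x) => q.code (fun y => emb (some (.inr y) : Option (p.Lab ⊕ q.Lab))) exit x
  | .query, emb, exit => fun
    | none => .inr fun a => emb (some a : Option Bool)
    | some a => .inl (.load (fun v => (v.1, v.2 && !a)) (.goto fun _ => exit))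
  | .reject, _, exit => fun _ => .inl (.load (fun v => (v.1, false)) (.goto fun _ => exit))

theorem stepAux_pushStmt {K Λ : Type} [DecidableEq K] (exit : Λ) (v : Reg) :
    ∀ (l : List (K × Symbol)) (S : Stacks K),
      Turing.TM2.stepAux (pushStmt l exit) v S = ⟨some exit, v, pushAll l S⟩
  | [], _ => rfl
  | _ :: l, _ => stepAux_pushStmt exit v l _

/-- The oracle machine with the given instructions. -/
@[reducible] def mkMachine (K Λ : Type) [DecidableEq K] [Fintype K] [Fintype Λ] (i q : K) (st : Λ)
    (instr : Λ → Instr K Λ) : OracleMachine where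
  K := K
  inputStk := i
  queryStk := q
  Λ := Λ
  start := st
  σ := Reg
  init := (none, true)
  instr := instr
  accept v := v.2

section

variable {K Λ : Type} [DecidableEq K] [Fintype K] [Fintype Λ] {i q : K} {st : Λ}
  {instr : Λ → Instr K Λ} {O : Set (List Symbol)}

theorem step_inl {x : Λ} {s} (h : instr x = .inl s) (v : Reg) (S : Stacks K) :
    (mkMachine K Λ i q st instr).step O ⟨some x, v, S⟩ = some (Turing.TM2.stepAux s v S) := by
  simp only [OracleMachine.step, h]

open Classical in
theorem step_inr {x : Λ} {f} (h : instr x = .inr f) (v : Reg) (S : Stacks K) :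
    (mkMachine K Λ i q st instr).step O ⟨some x, v, S⟩ =
      some ⟨some (f (decide (S q ∈ O))), v, Function.update S q []⟩ := by
  simp only [OracleMachine.step, h]

/-- The induction quantifies over all label embeddings and exits, so that a subprogram can be placed
inside a larger one with its successor's start as exit. The symbol register is overwritten by a pop
or peek before each use, hence its final value is left existential. -/
theorem Exec.reaches {p : Prog K} {b : Bool} {S : Stacks K} {b' : Bool} {S' : Stacks K} {t : ℕ}
    (h : Exec O q p b S b' S' t) : ∀ (emb : p.Lab → Λ) (exit : Λ),
      (∀ x, instr (emb x) = p.code emb exit x) → ∀ r, ∃ r',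
        (mkMachine K Λ i q st instr).Reaches O t ⟨some (emb p.start), (r, b), S⟩
          ⟨some exit, (r', b'), S'⟩ := by
  induction h with
  | pushes l b S =>
    intro emb exit hc r
    refine ⟨r, .single ?_⟩
    rw [step_inl (hc _), stepAux_pushStmt]
  | drain_nil hX =>
    intro emb exit hc r
    refine ⟨none, .single ?_⟩
    rw [step_inl (hc _)]
    simp only [Turing.TM2.stepAux, hX, List.head?_nil, List.tail_nil]
    rw [← hX, Function.update_eq_self]
  | @drain_found X last f b S s _ hX hs =>
    intro emb exit hc r
    refine ⟨some s, .single ?_⟩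
    rw [step_inl (hc _)]
    simp only [Turing.TM2.stepAux, hX, List.head?_cons, List.tail_cons, hs, cond_true]
  | @drain_cons X last f b S s u b' S' t hX hs _ ih =>
    intro emb exit hc r
    obtain ⟨r', h⟩ := ih emb exit hc (some s)
    -- Two steps per symbol: the popped symbol selects a label, and the statement at that label
    -- performs the pushes.
    refine ⟨r', OracleMachine.Reaches.head
      (d := ⟨some (emb (some s : Option Symbol)), (some s, b), Function.update S X u⟩) ?_
      (OracleMachine.Reaches.head ?_ h)⟩
    · rw [step_inl (hc _)]
      simp only [Turing.TM2.stepAux, hX, List.head?_cons, List.tail_cons, hs, cond_false]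
    · rw [step_inl (hc _), stepAux_pushStmt]
      rfl
  | seq _ _ ih ih' =>
    intro emb exit hc r
    obtain ⟨r₁, h₁⟩ := ih _ _ (fun x => hc (.inl x)) r
    obtain ⟨r₂, h₂⟩ := ih' _ _ (fun x => hc (.inr x)) r₁
    exact ⟨r₂, h₁.trans h₂⟩
  | while_nil hX =>
    intro emb exit hc r
    refine ⟨none, .single ?_⟩
    rw [step_inl (hc _)]
    simp only [Turing.TM2.stepAux, hX, List.head?_nil]
  | while_cons hX _ _ ih ih' =>
    intro emb exit hc r
    obtain ⟨s, u, hX⟩ := List.exists_cons_of_ne_nil hX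
    obtain ⟨r₁, h₁⟩ := ih _ _ (fun x => hc (some x)) (some s)
    obtain ⟨r₂, h₂⟩ := ih' _ _ hc r₁
    refine ⟨r₂, (OracleMachine.Reaches.trans (.single ?_) h₁).trans h₂⟩
    rw [step_inl (hc _)]
    simp only [Turing.TM2.stepAux, hX, List.head?_cons]
  | ifEmpty_nil hX _ ih =>
    intro emb exit hc r
    obtain ⟨r₁, h₁⟩ := ih _ _ (fun x => hc (some (.inl x))) none
    refine ⟨r₁, .head ?_ h₁⟩
    rw [step_inl (hc _)]
    simp only [Turing.TM2.stepAux, hX, List.head?_nil]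
  | ifEmpty_cons hX _ ih =>
    intro emb exit hc r
    obtain ⟨s, u, hX⟩ := List.exists_cons_of_ne_nil hX
    obtain ⟨r₁, h₁⟩ := ih _ _ (fun x => hc (some (.inr x))) (some s)
    refine ⟨r₁, .head ?_ h₁⟩
    rw [step_inl (hc _)]
    simp only [Turing.TM2.stepAux, hX, List.head?_cons]
  | query b S =>
    intro emb exit hc r
    refine ⟨r, .head (step_inr (hc _) _ _) (.single ?_)⟩
    rw [step_inl (hc _)]
    simp only [Turing.TM2.stepAux]
  | reject b S =>
    intro emb exit hc r
    refine ⟨r, .single ?_⟩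
    rw [step_inl (hc _)]
    simp only [Turing.TM2.stepAux]
  | mono _ ht ih =>
    intro emb exit hc r
    obtain ⟨r', h⟩ := ih emb exit hc r
    exact ⟨r', h.mono ht⟩

end

/-- The machine that runs a program and halts. -/
noncomputable def machine {K : Type} [DecidableEq K] [Fintype K] (p : Prog K) (i q : K) :
    OracleMachine :=
  have := finite_lab p
  letI := Fintype.ofFinite p.Lab
  mkMachine K (Option p.Lab) i q (some p.start) fun
    | none => .inl .halt
    | some x => p.code some none x

theorem Exec.haltsWithin {K : Type} [DecidableEq K] [Fintype K] {p : Prog K} {i q : K}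
    {O : Set (List Symbol)} {w : List Symbol} {b : Bool} {S : Stacks K} {t : ℕ}
    (h : Exec O q p true (Function.update (fun _ => []) i w) b S t) :
    (p.machine i q).HaltsWithin O w (t + 1) b := by
  have := finite_lab p
  let := Fintype.ofFinite p.Lab
  obtain ⟨r, h⟩ := h.reaches (i := i) (st := some p.start) (instr := fun
    | none => .inl .halt
    | some x => p.code some none x) some none (fun _ => rfl) none
  -- The one extra step executes `halt`.
  obtain ⟨u, hu, hr⟩ := (h.trans (.single (step_inl rfl _ _))).exists_run (w := w) (s := 0) rfl
  exact ⟨u, by omega, _, hr, rfl, rfl⟩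

end Prog

/-! ## Programs that move and copy words -/

namespace Prog

variable {K : Type} [DecidableEq K] {O : Set (List Symbol)} {q : K}

theorem Exec.congr {p : Prog K} {b b' : Bool} {S S₁ S' : Stacks K} {t t' : ℕ}
    (h : Exec O q p b S b' S₁ t) (ht : t ≤ t') (hS : S₁ = S') : Exec O q p b S b' S' t' :=
  hS ▸ h.mono ht

/-- Empty the stack `X` up to the first symbol that satisfies `last`, pushing the word `g s` on `Y`
and the word `h s` on `Z` for each symbol `s`. -/
def move (X : K) (last : Symbol → Bool) (Y : K) (g : Symbol → List Symbol) (Z : K)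
    (h : Symbol → List Symbol) : Prog K :=
  .drain X last fun s => (g s).map (Prod.mk Y) ++ (h s).map (Prod.mk Z)

theorem pushAll_map (Y : K) : ∀ (l : List Symbol) (S : Stacks K),
    pushAll (l.map (Prod.mk Y)) S = Function.update S Y (l.reverse ++ S Y)
  | [], S => by simp [pushAll]
  | a :: l, S => by
    have := pushAll_map Y l (Function.update S Y (a :: S Y))
    simp only [pushAll, List.map_cons, List.foldl_cons] at this ⊢
    rw [this]
    simp

theorem pushAll_append (l l' : List (K × Symbol)) (S : Stacks K) :
    pushAll (l ++ l') S = pushAll l' (pushAll l S) := by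
  simp [pushAll]

/-- Draining stops either at the bottom of the stack or at a terminator `c`, which is popped without
being copied. The copied words appear reversed because each push goes on top. -/
theorem exec_move {X Y Z : K} (hXY : X ≠ Y) (hXZ : X ≠ Z) (hYZ : Y ≠ Z) {last : Symbol → Bool}
    {g h : Symbol → List Symbol} {b : Bool} {rest r : List Symbol}
    (hr : rest = [] ∧ r = [] ∨ ∃ c, last c = true ∧ rest = c :: r) :
    ∀ (u : List Symbol) (S : Stacks K), S X = u ++ rest → (∀ s ∈ u, last s = false) →
      Exec O q (move X last Y g Z h) b S b
        (Function.update (Function.update (Function.update S X r)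
          Y ((u.flatMap g).reverse ++ S Y)) Z ((u.flatMap h).reverse ++ S Z))
        (2 * u.length + 1) := by
  intro u
  induction u with
  | nil =>
    intro S hX _
    have : Function.update (Function.update (Function.update S X r)
          Y ((([] : List Symbol).flatMap g).reverse ++ S Y)) Z
            ((([] : List Symbol).flatMap h).reverse ++ S Z) = Function.update S X r := by
      funext k
      by_cases hZ : k = Z
      · subst hZ
        simp [hXZ.symm]
      · by_cases hY : k = Y
        · subst hY
          simp [hXY.symm, hZ]
        · simp [hY, hZ]
    rw [this]
    rcases hr with ⟨rfl, rfl⟩ | ⟨c, hc, rfl⟩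
    · have hX' : S X = [] := hX
      have h0 : Function.update S X [] = S := by rw [← hX', Function.update_eq_self]
      rw [h0]
      exact .drain_nil hX'
    · exact .drain_found hX hc
  | cons s u ih =>
    intro S hX hu
    have h1 := ih (Function.update (Function.update (Function.update S X (u ++ rest))
      Y ((g s).reverse ++ S Y)) Z ((h s).reverse ++ S Z)) (by simp [hXY, hXZ])
      (fun s hs => hu s (by simp [hs]))
    have h2 : pushAll ((g s).map (Prod.mk Y) ++ (h s).map (Prod.mk Z))
        (Function.update S X (u ++ rest)) = Function.update (Function.update (Function.update S X
          (u ++ rest)) Y ((g s).reverse ++ S Y)) Z ((h s).reverse ++ S Z) := by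
      rw [pushAll_append, pushAll_map, pushAll_map, Function.update_of_ne hXY.symm,
        Function.update_of_ne hYZ.symm, Function.update_of_ne hXZ.symm]
    rw [← h2] at h1
    refine (Exec.drain_cons hX (hu s (by simp)) h1).congr (by simp; omega) ?_
    rw [h2]
    funext k
    by_cases hZ : k = Z
    · subst hZ
      simp
    · by_cases hY : k = Y
      · subst hY
        simp [hZ]
      · by_cases hX' : k = X
        · subst hX'
          simp [hY, hZ]
        · simp [hY, hZ, hX']

/-- Push the words `g s` for the symbols `s` of `X`, from top to bottom, on `Y`. The stack `T` is
used temporarily. -/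
def copyRev (X Y T : K) (g : Symbol → List Symbol) : Prog K :=
  .seq (.move X (fun _ => false) Y g T fun s => [s])
    (.move T (fun _ => false) X (fun s => [s]) Y fun _ => [])

/-- Push the words `g s` for the symbols `s` of `X`, from bottom to top, on `Y`. The stack `T` is
used temporarily. -/
def copy (X Y T : K) (g : Symbol → List Symbol) : Prog K :=
  .seq (.move X (fun _ => false) T (fun s => [s]) Y fun _ => [])
    (.move T (fun _ => false) X (fun s => [s]) Y g)

/-- Moving `X` to `T` and back restores both. The pushes on `Y` happen on the way out here and on
the way back in `copy`, which decides the orientation of the result. -/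
theorem exec_copyRev {X Y T : K} (hXY : X ≠ Y) (hXT : X ≠ T) (hYT : Y ≠ T)
    {g : Symbol → List Symbol} {b : Bool} {S : Stacks K} {W : ℕ} (hT : S T = [])
    (hW : (S X).length ≤ W) :
    Exec O q (copyRev X Y T g) b S b
      (Function.update S Y (((S X).flatMap g).reverse ++ S Y)) (4 * W + 2) := by
  have h1 := exec_move (O := O) (q := q) (b := b) hXY hXT hYT (last := fun _ => false) (g := g)
    (h := fun s => [s]) (rest := []) (Or.inl ⟨rfl, rfl⟩) (S X) S (by simp)
    (fun _ _ => rfl)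
  refine (h1.seq (exec_move hXT.symm hYT.symm hXY (rest := []) (Or.inl ⟨rfl, rfl⟩)
    (S X).reverse _ ?_ (fun _ _ => rfl))).congr ?_ ?_
  · simp [hT]
  · simp
    omega
  · funext k
    by_cases hkT : k = T
    · subst hkT
      simp [hXT.symm, hYT.symm, hT]
    · by_cases hY : k = Y
      · subst hY
        simp [hkT]
      · by_cases hX' : k = X
        · subst hX'
          simp [hY, hkT]
        · simp [hY, hkT, hX']

theorem exec_copy {X Y T : K} (hXY : X ≠ Y) (hXT : X ≠ T) (hYT : Y ≠ T)
    {g : Symbol → List Symbol} {b : Bool} {S : Stacks K} {W : ℕ} (hT : S T = [])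
    (hW : (S X).length ≤ W) :
    Exec O q (copy X Y T g) b S b
      (Function.update S Y (((S X).reverse.flatMap g).reverse ++ S Y)) (4 * W + 2) := by
  have h1 := exec_move (O := O) (q := q) (b := b) hXT hXY hYT.symm (last := fun _ => false)
    (g := fun s => [s]) (h := fun _ => []) (rest := []) (Or.inl ⟨rfl, rfl⟩) (S X) S (by simp)
    (fun _ _ => rfl)
  refine (h1.seq (exec_move hXT.symm hYT.symm hXY (rest := []) (Or.inl ⟨rfl, rfl⟩)
    (S X).reverse _ ?_ (fun _ _ => rfl))).congr ?_ ?_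
  · simp [hT, hYT.symm]
  · simp
    omega
  · funext k
    by_cases hkT : k = T
    · subst hkT
      simp [hXT.symm, hYT.symm, hT]
    · by_cases hY : k = Y
      · subst hY
        simp
      · by_cases hX' : k = X
        · subst hX'
          simp [hY, hkT]
        · simp [hY, hkT, hX']

end Prog

/-! ## The reduction as a program -/

open Prog

/-- The stacks of the reduction. -/
inductive Stk
  /-- the input, later the rows of the matrix -/
  | inp
  | query
  /-- the unprocessed entries of the vector -/
  | todo
  /-- the processed entries of the vector, reversed -/
  | done
  /-- the current entry of the vector, reversed -/
  | cur
  /-- the number of columns in unary -/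
  | dim
  /-- a large number -/
  | big
  | tmp
  /-- the remaining off-diagonal coefficients -/
  | coef
  /-- a comma for each coefficient that has been used -/
  | used
  /-- the current coefficient, reversed -/
  | val
  deriving DecidableEq

instance : Fintype Stk where
  elems := {.inp, .query, .todo, .done, .cur, .dim, .big, .tmp, .coef, .used, .val}
  complete x := by cases x <;> decide

/-- The contents of the stacks of the reduction. -/
structure Mem where
  inp : List Symbol
  query : List Symbol
  todo : List Symbol
  done : List Symbol
  cur : List Symbol
  dim : List Symbol
  big : List Symbol
  tmp : List Symbol
  coef : List Symbol
  used : List Symbol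
  val : List Symbol

/-- The memory as a family of stacks. -/
def Mem.stacks (m : Mem) : Stacks Stk
  | .inp => m.inp
  | .query => m.query
  | .todo => m.todo
  | .done => m.done
  | .cur => m.cur
  | .dim => m.dim
  | .big => m.big
  | .tmp => m.tmp
  | .coef => m.coef
  | .used => m.used
  | .val => m.val

section

variable (m : Mem) (v : List Symbol)

@[simp] theorem update_inp :
    Function.update m.stacks .inp v = { m with inp := v }.stacks := by funext k; cases k <;> rfl

@[simp] theorem update_query :
    Function.update m.stacks .query v = { m with query := v }.stacks := by
  funext k; cases k <;> rfl

@[simp] theorem update_todo :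
    Function.update m.stacks .todo v = { m with todo := v }.stacks := by funext k; cases k <;> rfl

@[simp] theorem update_done :
    Function.update m.stacks .done v = { m with done := v }.stacks := by funext k; cases k <;> rfl

@[simp] theorem update_cur :
    Function.update m.stacks .cur v = { m with cur := v }.stacks := by funext k; cases k <;> rfl

@[simp] theorem update_dim :
    Function.update m.stacks .dim v = { m with dim := v }.stacks := by funext k; cases k <;> rfl

@[simp] theorem update_big :
    Function.update m.stacks .big v = { m with big := v }.stacks := by funext k; cases k <;> rfl

@[simp] theorem update_tmp :
    Function.update m.stacks .tmp v = { m with tmp := v }.stacks := by funext k; cases k <;> rfl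

@[simp] theorem update_coef :
    Function.update m.stacks .coef v = { m with coef := v }.stacks := by funext k; cases k <;> rfl

@[simp] theorem update_used :
    Function.update m.stacks .used v = { m with used := v }.stacks := by funext k; cases k <;> rfl

@[simp] theorem update_val :
    Function.update m.stacks .val v = { m with val := v }.stacks := by funext k; cases k <;> rfl

end

/-- The word that is pushed instead of a symbol when entries are replaced by `∞`. -/
def blankWord (s : Symbol) : List Symbol :=
  if s = .comma then [.comma, .infty] else []

/-- The word that is pushed instead of a symbol when two entries `∞` are appended to each row. -/
def extendWord (s : Symbol) : List Symbol :=
  if s = .semicolon then [.semicolon, .comma, .infty, .comma, .infty] else [s]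

theorem encodeList_append (u v : List ZInf) : encodeList (u ++ v) = encodeList u ++ encodeList v :=
  List.flatMap_append

theorem encodeList_cons (a : ZInf) (v : List ZInf) :
    encodeList (a :: v) = encodeEntry a ++ Symbol.comma :: encodeList v := by
  simp [encodeList]

theorem encodeRows_append (u v : List (List ZInf)) :
    encodeRows (u ++ v) = encodeRows u ++ encodeRows v :=
  List.flatMap_append

theorem encodeRows_cons (a : List ZInf) (v : List (List ZInf)) :
    encodeRows (a :: v) = encodeList a ++ Symbol.semicolon :: encodeRows v := by
  simp [encodeRows]

/-- Commas act as unary counters of columns: any stack with the right number of them yields a block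
of entries `∞`, whatever else it holds. -/
theorem reverse_flatMap_blankWord (u : List Symbol) :
    (u.flatMap blankWord).reverse = encodeList (List.replicate (u.count .comma) ⊤) := by
  induction u with
  | nil => rfl
  | cons s u ih =>
    rw [List.flatMap_cons, List.reverse_append, ih]
    by_cases hs : s = .comma
    · subst hs
      rw [List.count_cons_self, List.replicate_succ', encodeList_append]
      rfl
    · rw [List.count_cons_of_ne hs]
      simp [blankWord, hs]

theorem count_comma_encodeList (v : List ZInf) : (encodeList v).count .comma = v.length := by
  induction v with
  | nil => rfl
  | cons a v ih =>
    have : (encodeEntry a).count .comma = 0 :=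
      List.count_eq_zero.2 fun h => (mem_encodeEntry h).1 rfl
    rw [encodeList_cons, List.count_append, List.count_cons_self, ih, this, List.length_cons,
      zero_add]

theorem semicolon_notMem_encodeList (v : List ZInf) : Symbol.semicolon ∉ encodeList v := by
  intro h
  simp only [encodeList, List.mem_flatMap, List.mem_append, List.mem_singleton] at h
  obtain ⟨a, -, h | h⟩ := h
  · exact (mem_encodeEntry h).2 rfl
  · simp at h

theorem reverse_flatMap_reverse {α β : Type} (g : α → List β) (u : List α) :
    (u.reverse.flatMap g).reverse = u.flatMap fun s => (g s).reverse := by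
  induction u with
  | nil => rfl
  | cons s u ih => simp [ih]

/-- Copying starts from the end of the word, so the semicolon of a row is met before its entries,
and the two entries `∞` can be pushed right in front of it. -/
theorem reverse_flatMap_extendWord (rows : List (List ZInf)) :
    ((encodeRows rows).reverse.flatMap extendWord).reverse =
      encodeRows (rows.map fun r => r ++ [⊤, ⊤]) := by
  rw [reverse_flatMap_reverse]
  induction rows with
  | nil => rfl
  | cons r rows ih =>
    have h : ∀ u : List Symbol, Symbol.semicolon ∉ u →
        (u.flatMap fun s => (extendWord s).reverse) = u := by
      intro u hu
      induction u with
      | nil => rfl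
      | cons s u ih =>
        rw [List.mem_cons, not_or] at hu
        rw [List.flatMap_cons, ih hu.2, extendWord, if_neg (Ne.symm hu.1)]
        rfl
    rw [encodeRows_cons, List.flatMap_append, h _ (semicolon_notMem_encodeList r),
      List.flatMap_cons, ih, List.map_cons, encodeRows_cons, encodeList_append]
    simp [extendWord, encodeList, encodeEntry_top]

/-- Prepend to the query the entry on `X` (in reverse), preceded by an entry `∞` for every comma on
`pre` and followed by an entry `∞` for every comma on `suf`. -/
def emitUnit (pre X suf : Stk) : Prog Stk :=
  .seq (copyRev suf .query .tmp blankWord) <|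
  .seq (.pushes [(.query, .comma)]) <|
  .seq (copyRev X .query .tmp fun s => [s]) <|
  copyRev pre .query .tmp blankWord

variable {O : Set (List Symbol)} {b : Bool} {W : ℕ}

/-- The top of the query stack is the first symbol of the query, so a row is written from its right
end. The entry on `X` is stored in reverse and is turned around by the copying. -/
theorem exec_emitUnit {pre X suf : Stk} {S : Stacks Stk} {c : ZInf} {i r : ℕ}
    (hpre : pre ≠ .query ∧ pre ≠ .tmp) (hX : X ≠ .query ∧ X ≠ .tmp)
    (hsuf : suf ≠ .query ∧ suf ≠ .tmp) (hT : S .tmp = []) (hc : S X = (encodeEntry c).reverse)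
    (hi : (S pre).count .comma = i) (hr : (S suf).count .comma = r)
    (hWp : (S pre).length ≤ W) (hWX : (S X).length ≤ W) (hWs : (S suf).length ≤ W) :
    Exec O .query (emitUnit pre X suf) b S b
      (Function.update S .query
        (encodeList (List.replicate i ⊤ ++ c :: List.replicate r ⊤) ++ S .query)) (12 * W + 7) := by
  have hqT : Stk.query ≠ Stk.tmp := by decide
  refine ((exec_copyRev hsuf.1 hsuf.2 hqT hT hWs).seq ((Exec.pushes _ _ _).seq
    ((exec_copyRev (W := W) hX.1 hX.2 hqT ?_ ?_).seq
      (exec_copyRev (W := W) hpre.1 hpre.2 hqT ?_ ?_)))).congr ?_ ?_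
  · simp [pushAll, hT]
  · simpa [pushAll, hX] using hWX
  · simp [pushAll, hT]
  · simpa [pushAll, hpre] using hWp
  · omega
  · simp [pushAll, hpre, hX, hc, reverse_flatMap_blankWord, hi, hr, encodeList_append,
      encodeList_cons]

/-- The row with the coefficient `c` in column `i`, the coefficient `d` in two additional columns,
and `∞` elsewhere. -/
def unitList (i : ℕ) (c : ZInf) (r : ℕ) (d : ZInf) : List ZInf :=
  List.replicate i ⊤ ++ c :: List.replicate r ⊤ ++ [d, d]

/-- Prepend to the query a row with the entry on `X` (in reverse) and, in two additional columns,
the current entry of the vector. -/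
def emitRow (pre X suf : Stk) : Prog Stk :=
  .seq (.pushes [(.query, .semicolon), (.query, .comma)]) <|
  .seq (copyRev .cur .query .tmp fun s => [s]) <|
  .seq (.pushes [(.query, .comma)]) <|
  .seq (copyRev .cur .query .tmp fun s => [s]) <|
  emitUnit pre X suf

theorem exec_emitRow {pre X suf : Stk} {S : Stacks Stk} {c d : ZInf} {i r : ℕ}
    (hpre : pre ≠ .query ∧ pre ≠ .tmp) (hX : X ≠ .query ∧ X ≠ .tmp)
    (hsuf : suf ≠ .query ∧ suf ≠ .tmp) (hT : S .tmp = []) (hc : S X = (encodeEntry c).reverse)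
    (hd : S .cur = (encodeEntry d).reverse)
    (hi : (S pre).count .comma = i) (hr : (S suf).count .comma = r)
    (hWp : (S pre).length ≤ W) (hWX : (S X).length ≤ W) (hWs : (S suf).length ≤ W)
    (hWd : (S .cur).length ≤ W) :
    Exec O .query (emitRow pre X suf) b S b
      (Function.update S .query
        (encodeList (unitList i c r d) ++ Symbol.semicolon :: S .query)) (20 * W + 13) := by
  have hqT : Stk.query ≠ Stk.tmp := by decide
  have hcq : Stk.cur ≠ Stk.query := by decide
  have hct : Stk.cur ≠ Stk.tmp := by decide
  refine ((Exec.pushes _ _ _).seq ((exec_copyRev (W := W) hcq hct hqT ?_ ?_).seq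
    ((Exec.pushes _ _ _).seq ((exec_copyRev (W := W) hcq hct hqT ?_ ?_).seq
    (exec_emitUnit (c := c) (i := i) (r := r) (W := W) hpre hX hsuf ?_ ?_ ?_ ?_ ?_ ?_ ?_))))).congr
      ?_ ?_
  · simp [pushAll, hT]
  · simpa [pushAll] using hWd
  · simp [pushAll, hT]
  · simpa [pushAll] using hWd
  · simp [pushAll, hT]
  · simpa [pushAll, hX] using hc
  · simpa [pushAll, hpre] using hi
  · simpa [pushAll, hsuf] using hr
  · simpa [pushAll, hpre] using hWp
  · simpa [pushAll, hX] using hWX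
  · simpa [pushAll, hsuf] using hWs
  · omega
  · simp [pushAll, hd, unitList, encodeList]

/-- Empty the stack `X`. -/
def clear (X : Stk) : Prog Stk :=
  .move X (fun _ => false) .query (fun _ => []) .tmp fun _ => []

theorem exec_clear {X : Stk} (hX : X ≠ .query ∧ X ≠ .tmp) {S : Stacks Stk}
    (hW : (S X).length ≤ W) :
    Exec O .query (clear X) b S b (Function.update S X []) (2 * W + 1) := by
  refine (exec_move hX.1 hX.2 (by decide) (rest := []) (Or.inl ⟨rfl, rfl⟩) (S X) S (by simp)
    (fun _ _ => rfl)).congr (by omega) ?_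
  funext k
  by_cases hq : k = .query
  · subst hq
    simp [hX.1.symm]
  · by_cases ht : k = .tmp
    · subst ht
      simp [hX.2.symm]
    · simp [hq, ht]

/-- Emit the two rows of the query that belong to the first remaining coefficient. -/
def emitCoef : Prog Stk :=
  .seq (.move .coef (fun s => s = .comma) .val (fun s => [s]) .tmp fun _ => []) <|
  .seq (emitRow .used .val .coef) <|
  .seq (emitRow .used .big .coef) <|
  .seq (clear .val) <|
  .pushes [(.used, .comma)]

/-- The rows that are emitted for the coefficients `v`, `i` of which have been used before. -/
def coefRows (c d : ZInf) : ℕ → List ZInf → List (List ZInf)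
  | _, [] => []
  | i, a :: v => coefRows c d (i + 1) v ++ [unitList i c v.length d, unitList i a v.length d]

theorem exec_move_entry {X Y : Stk} (hXY : X ≠ Y) (hX : X ≠ .tmp) (hY : Y ≠ .tmp) {S : Stacks Stk}
    {a : ZInf} {v : List ZInf} (hS : S X = encodeList (a :: v)) (hSY : S Y = [])
    (hW : (S X).length ≤ W) :
    Exec O .query (.move X (fun s => s = .comma) Y (fun s => [s]) .tmp fun _ => []) b S b
      (Function.update (Function.update S X (encodeList v)) Y (encodeEntry a).reverse)
      (2 * W + 1) := by
  refine (exec_move hXY hX hY (rest := .comma :: encodeList v)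
    (Or.inr ⟨.comma, by simp, rfl⟩) (encodeEntry a) S (by rw [hS, encodeList_cons])
    fun s hs => by simpa using (mem_encodeEntry hs).1).congr ?_ ?_
  · have := congrArg List.length hS
    rw [encodeList_cons, List.length_append] at this
    omega
  · funext k
    by_cases ht : k = .tmp
    · subst ht
      simp [hX.symm, hY.symm]
    · simp [hSY, ht]

/-- Once the current coefficient has left `coef`, the commas on `used` count the columns to its left
and those on `coef` the columns to its right. -/
theorem exec_emitCoef {R Q L P N : List Symbol} {c d a : ZInf} {v : List ZInf} {i : ℕ}
    (hd : (encodeEntry d).length ≤ W) (hc : (encodeEntry c).length ≤ W)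
    (hv : (encodeList (a :: v)).length ≤ W) (hi : i ≤ W) :
    Exec O .query emitCoef b
      (Mem.mk R Q L P (encodeEntry d).reverse N (encodeEntry c).reverse [] (encodeList (a :: v))
        (List.replicate i .comma) []).stacks b
      (Mem.mk R (encodeRows [unitList i c v.length d, unitList i a v.length d] ++ Q) L P
        (encodeEntry d).reverse N (encodeEntry c).reverse [] (encodeList v)
        (List.replicate (i + 1) .comma) []).stacks (44 * W + 29) := by
  have hv' : (encodeEntry a).length + (encodeList v).length + 1 ≤ W := by
    rw [encodeList_cons, List.length_append, List.length_cons] at hv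
    omega
  refine ((exec_move_entry (W := W) (by decide) (by decide) (by decide) rfl rfl hv).seq
    ((exec_emitRow (W := W) (c := a) (d := d) (i := i) (r := v.length) (by decide) (by decide)
      (by decide) ?_ ?_ ?_ ?_ ?_ ?_ ?_ ?_ ?_).seq
    ((exec_emitRow (W := W) (c := c) (d := d) (i := i) (r := v.length) (by decide) (by decide)
      (by decide) ?_ ?_ ?_ ?_ ?_ ?_ ?_ ?_ ?_).seq
    ((exec_clear (W := W) (by decide) ?_).seq (Exec.pushes _ _ _))))).congr ?_ ?_ <;>
  (try simp [Mem.stacks, pushAll, count_comma_encodeList])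
  all_goals (try omega)
  all_goals (try simp [encodeRows, List.replicate_succ])

theorem encodeList_nil : encodeList [] = [] := rfl

theorem length_le_length_encodeList (v : List ZInf) : v.length ≤ (encodeList v).length := by
  rw [← count_comma_encodeList v]
  exact List.count_le_length

theorem exec_emitCoefs {R L P N : List Symbol} {c d : ZInf}
    (hd : (encodeEntry d).length ≤ W) (hc : (encodeEntry c).length ≤ W) :
    ∀ (v : List ZInf) (i : ℕ) (Q : List Symbol), (encodeList v).length ≤ W → i + v.length ≤ W →
    Exec O .query (.whileNonempty .coef emitCoef) b
      (Mem.mk R Q L P (encodeEntry d).reverse N (encodeEntry c).reverse [] (encodeList v)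
        (List.replicate i .comma) []).stacks b
      (Mem.mk R (encodeRows (coefRows c d i v) ++ Q) L P
        (encodeEntry d).reverse N (encodeEntry c).reverse [] []
        (List.replicate (i + v.length) .comma) []).stacks (v.length * (44 * W + 30) + 1) := by
  intro v
  induction v with
  | nil =>
    intro i Q _ _
    exact (Exec.while_nil rfl).congr (by simp) (by simp [coefRows, encodeRows, encodeList])
  | cons a v ih =>
    intro i Q hv hi
    rw [List.length_cons] at hi
    have hv' : (encodeList v).length ≤ W := by
      rw [encodeList_cons, List.length_append, List.length_cons] at hv
      omega
    refine (Exec.while_cons (by simp [Mem.stacks, encodeList_cons])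
      (exec_emitCoef hd hc hv (by omega)) (ih (i + 1) _ hv' (by omega))).congr ?_ ?_
    · rw [List.length_cons, add_one_mul]
      omega
    · simp [coefRows, encodeRows_append, Nat.add_assoc, Nat.add_comm 1]

/-! ### The query of one column -/

/-- The rows of the query for the entry `a` of the vector `u ++ a :: v`. -/
def queryList (rows : List (List ZInf)) (c : ZInf) (u : List ZInf) (a : ZInf) (v : List ZInf) :
    List (List ZInf) :=
  rows.map (fun r => r ++ [⊤, ⊤]) ++
    (List.replicate u.length ⊤ ++ 1 :: List.replicate v.length ⊤ ++ [⊤, 0]) ::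
    (List.replicate u.length ⊤ ++ 1 :: List.replicate v.length ⊤ ++ [0, ⊤]) ::
    coefRows c a 0 (u ++ ⊤ :: v)

/-- The query for the entry `a` of the vector `u ++ a :: v`. -/
def queryWord (n : ℕ) (rows : List (List ZInf)) (c : ZInf) (u : List ZInf) (a : ZInf)
    (v : List ZInf) : List Symbol :=
  List.replicate (n + 2) (Symbol.bit true) ++ [Symbol.semicolon] ++
    encodeRows (queryList rows c u a v)

/-- Make the first unprocessed entry of the vector the current one, and list the coefficients of the
rows that refer to it. -/
def loadEntry : Prog Stk :=
  .seq (.move .todo (fun s => s = .comma) .cur (fun s => [s]) .tmp fun _ => []) <|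
  .seq (copy .todo .coef .tmp fun s => [s]) <|
  .seq (.pushes [(.coef, .comma), (.coef, .infty)]) <|
  copyRev .done .coef .tmp fun s => [s]

/-- Emit the part of the query that precedes the rows for the coefficients. -/
def emitHead : Prog Stk :=
  .seq (clear .used) <|
  .seq (.pushes [(.val, .bit true), (.query, .semicolon), (.query, .comma), (.query, .infty),
    (.query, .comma)]) <|
  .seq (emitUnit .done .val .todo) <|
  .seq (.pushes [(.query, .semicolon), (.query, .comma), (.query, .comma), (.query, .infty)]) <|
  .seq (emitUnit .done .val .todo) <|
  .seq (clear .val) <|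
  .seq (copy .inp .query .tmp extendWord) <|
  .seq (.pushes [(.query, .semicolon), (.query, .bit true), (.query, .bit true)]) <|
  copy .dim .query .tmp fun s => [s]

/-- Ask the query, and declare the current entry of the vector processed. -/
def storeEntry : Prog Stk :=
  .seq .query <|
  .seq (copy .cur .done .tmp fun s => [s]) <|
  .seq (clear .cur) <|
  .pushes [(.done, .comma)]

/-- Prepare and ask the query that belongs to the first unprocessed entry of the vector. -/
def askEntry : Prog Stk :=
  .seq loadEntry <| .seq (.whileNonempty .coef emitCoef) <| .seq emitHead storeEntry

/-- The coefficient list is the vector with its current entry replaced by `∞`. The current column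
then needs no special case: its off-diagonal row is vacuous. -/
theorem exec_loadEntry {R N C : List Symbol} {a : ZInf} {u v : List ZInf}
    (huv : (encodeList (u ++ a :: v)).length ≤ W) :
    Exec O .query loadEntry b
      (Mem.mk R [] (encodeList (a :: v)) (encodeList u).reverse [] N C [] [] [] []).stacks b
      (Mem.mk R [] (encodeList v) (encodeList u).reverse (encodeEntry a).reverse N C []
        (encodeList (u ++ ⊤ :: v)) (List.replicate 0 .comma) []).stacks (10 * W + 6) := by
  rw [encodeList_append, List.length_append] at huv
  have hav : (encodeList (a :: v)).length = (encodeEntry a).length + 1 + (encodeList v).length := by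
    rw [encodeList_cons, List.length_append, List.length_cons]
    omega
  refine ((exec_move_entry (W := W) (by decide) (by decide) (by decide) rfl rfl ?_).seq
    ((exec_copy (W := W) (by decide) (by decide) (by decide) ?_ ?_).seq ((Exec.pushes _ _ _).seq
      (exec_copyRev (W := W) (by decide) (by decide) (by decide) ?_ ?_)))).congr ?_ ?_
  · simp only [Mem.stacks]
    omega
  · simp [Mem.stacks]
  · simp only [update_todo, update_cur, Mem.stacks]
    omega
  · simp [Mem.stacks, pushAll]
  · simp [Mem.stacks, pushAll]
    omega
  · omega
  · simp [Mem.stacks, pushAll, encodeList_append, encodeList_cons, encodeEntry_top]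

/-- Zero is written as the empty word, so an appended coefficient `0` is a bare comma, and the
coefficient `1` is a single digit. Two digits are pushed besides those of `dim` to account for the
additional columns. -/
theorem exec_emitHead {rows rows' : List (List ZInf)} {cur C : List Symbol} {n i : ℕ}
    {u v : List ZInf} (hR : (encodeRows rows).length ≤ W) (hn : n ≤ W) (hi : i ≤ W)
    (hu : (encodeList u).length ≤ W) (hv : (encodeList v).length ≤ W) (hW : 1 ≤ W) :
    Exec O .query emitHead b
      (Mem.mk (encodeRows rows) (encodeRows rows') (encodeList v) (encodeList u).reverse cur
        (List.replicate n (.bit true)) C [] [] (List.replicate i .comma) []).stacks b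
      (Mem.mk (encodeRows rows) (List.replicate (n + 2) (.bit true) ++ [.semicolon] ++
          encodeRows (rows.map (fun r => r ++ [⊤, ⊤]) ++
            (List.replicate u.length ⊤ ++ 1 :: List.replicate v.length ⊤ ++ [⊤, 0]) ::
            (List.replicate u.length ⊤ ++ 1 :: List.replicate v.length ⊤ ++ [0, ⊤]) :: rows'))
        (encodeList v) (encodeList u).reverse cur
        (List.replicate n (.bit true)) C [] [] [] []).stacks (36 * W + 23) := by
  refine ((exec_clear (W := W) (by decide) ?_).seq ((Exec.pushes _ _ _).seq
    ((exec_emitUnit (W := W) (c := 1) (i := u.length) (r := v.length) (by decide) (by decide)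
      (by decide) ?_ ?_ ?_ ?_ ?_ ?_ ?_).seq ((Exec.pushes _ _ _).seq
    ((exec_emitUnit (W := W) (c := 1) (i := u.length) (r := v.length) (by decide) (by decide)
      (by decide) ?_ ?_ ?_ ?_ ?_ ?_ ?_).seq ((exec_clear (W := W) (by decide) ?_).seq
    ((exec_copy (W := W) (by decide) (by decide) (by decide) ?_ ?_).seq ((Exec.pushes _ _ _).seq
      (exec_copy (W := W) (by decide) (by decide) (by decide) ?_ ?_))))))))).congr ?_ ?_ <;>
  (try simp [Mem.stacks, pushAll, count_comma_encodeList, encodeEntry_one,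
    reverse_flatMap_extendWord, encodeRows_append, encodeRows_cons, encodeList_append,
    encodeList_cons, encodeEntry_top, encodeEntry_zero, List.replicate_succ', encodeList_nil])
  all_goals omega

open Classical in
theorem exec_storeEntry {R Q L N C : List Symbol} {a : ZInf} {u : List ZInf}
    (ha : (encodeEntry a).length ≤ W) :
    Exec O .query storeEntry b
      (Mem.mk R Q L (encodeList u).reverse (encodeEntry a).reverse N C [] [] [] []).stacks
      (b && !decide (Q ∈ O))
      (Mem.mk R [] L (encodeList (u ++ [a])).reverse [] N C [] [] [] []).stacks (6 * W + 6) := by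
  refine ((Exec.query _ _).seq
    ((exec_copy (W := W) (by decide) (by decide) (by decide) ?_ ?_).seq
    ((exec_clear (W := W) (by decide) ?_).seq (Exec.pushes _ _ _)))).congr ?_ ?_ <;>
  (try simp [Mem.stacks, pushAll, encodeList_append, encodeList_cons, encodeList_nil])
  all_goals omega

open Classical in
theorem exec_askEntry {n : ℕ} {rows : List (List ZInf)} {c a : ZInf} {u v : List ZInf} {b : Bool}
    (hR : (encodeRows rows).length ≤ W) (hc : (encodeEntry c).length ≤ W) (hn : n ≤ W)
    (huv : (encodeList (u ++ a :: v)).length + 2 ≤ W) :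
    Exec O .query askEntry b
      (Mem.mk (encodeRows rows) [] (encodeList (a :: v)) (encodeList u).reverse []
        (List.replicate n (.bit true)) (encodeEntry c).reverse [] [] [] []).stacks
      (b && !decide (queryWord n rows c u a v ∈ O))
      (Mem.mk (encodeRows rows) [] (encodeList v) (encodeList (u ++ [a])).reverse []
        (List.replicate n (.bit true)) (encodeEntry c).reverse [] [] [] []).stacks
      (44 * W * W + 82 * W + 36) := by
  have hlen : (encodeList u).length + ((encodeEntry a).length + 1 + (encodeList v).length) + 2
      ≤ W := by
    rw [encodeList_append, encodeList_cons, List.length_append, List.length_append,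
      List.length_cons] at huv
    omega
  have hu := length_le_length_encodeList u
  have hv := length_le_length_encodeList v
  have hav : (encodeList (a :: v)).length ≤ W := by
    rw [encodeList_cons, List.length_append, List.length_cons]
    omega
  -- Replacing an entry `0`, the empty word, by `∞` adds one symbol; the slack in `huv` absorbs it.
  have huv' : (encodeList (u ++ ⊤ :: v)).length ≤ W := by
    rw [encodeList_append, encodeList_cons, List.length_append, List.length_append,
      List.length_cons, encodeEntry_top, List.length_singleton]
    omega
  have huv'' : (u ++ ⊤ :: v).length ≤ W := by
    rw [List.length_append, List.length_cons]
    omega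
  have hmul : (u ++ ⊤ :: v).length * (44 * W + 30) ≤ W * (44 * W + 30) :=
    Nat.mul_le_mul_right _ huv''
  have h1 := exec_emitCoefs (O := O) (b := b) (R := encodeRows rows) (L := encodeList v)
    (P := (encodeList u).reverse) (N := List.replicate n (.bit true)) (c := c) (d := a)
    (W := W) (by omega) hc (u ++ ⊤ :: v) 0 [] huv' (by omega)
  rw [List.append_nil] at h1
  have h2 := exec_emitHead (O := O) (b := b) (cur := (encodeEntry a).reverse)
    (C := (encodeEntry c).reverse) (rows' := coefRows c a 0 (u ++ ⊤ :: v)) (u := u) (v := v)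
    (i := 0 + (u ++ ⊤ :: v).length) hR hn (by omega) (by omega) (by omega) (by omega)
  exact ((exec_loadEntry (W := W) (by omega)).seq (h1.seq (h2.seq
    (exec_storeEntry (W := W) (by omega))))).congr (by nlinarith) rfl

/-- Ask the queries for all entries of the vector. -/
def askEntries : Prog Stk := .whileNonempty .todo askEntry

open Classical in
/-- The verdict after the queries for the entries `v`, preceded by `u` in the vector. -/
noncomputable def verdict (O : Set (List Symbol)) (n : ℕ) (rows : List (List ZInf)) (c : ZInf) :
    List ZInf → List ZInf → Bool → Bool
  | _, [], b => b
  | u, a :: v, b => verdict O n rows c (u ++ [a]) v (b && !decide (queryWord n rows c u a v ∈ O))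

/-- The splittings of `v` stand for the columns still to be asked about. -/
theorem verdict_eq_true {n : ℕ} {rows : List (List ZInf)} {c : ZInf} :
    ∀ (v u : List ZInf) (b : Bool), verdict O n rows c u v b = true ↔
      b = true ∧ ∀ v₁ a v₂, v = v₁ ++ a :: v₂ → queryWord n rows c (u ++ v₁) a v₂ ∉ O := by
  intro v
  induction v with
  | nil => simp [verdict]
  | cons a v ih =>
    intro u b
    rw [verdict, ih]
    simp only [Bool.and_eq_true, Bool.not_eq_true', decide_eq_false_iff_not, and_assoc]
    refine and_congr_right fun _ => ⟨?_, fun h => ⟨?_, ?_⟩⟩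
    · rintro ⟨h1, h2⟩ (_ | ⟨d, v₁⟩) e v₂ hv
      · rw [List.nil_append, List.cons.injEq] at hv
        obtain ⟨rfl, rfl⟩ := hv
        simpa using h1
      · rw [List.cons_append, List.cons.injEq] at hv
        obtain ⟨rfl, rfl⟩ := hv
        simpa using h2 v₁ e v₂ rfl
    · simpa using h [] a v rfl
    · rintro v₁ e v₂ rfl
      simpa using h (a :: v₁) e v₂ rfl

theorem exec_askEntries {n : ℕ} {rows : List (List ZInf)} {c : ZInf}
    (hR : (encodeRows rows).length ≤ W) (hc : (encodeEntry c).length ≤ W) (hn : n ≤ W) :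
    ∀ (v u : List ZInf) (b : Bool), (encodeList (u ++ v)).length + 2 ≤ W →
    ∃ S, Exec O .query askEntries b
      (Mem.mk (encodeRows rows) [] (encodeList v) (encodeList u).reverse []
        (List.replicate n (.bit true)) (encodeEntry c).reverse [] [] [] []).stacks
      (verdict O n rows c u v b) S (v.length * (44 * W * W + 82 * W + 37) + 1) := by
  intro v
  induction v with
  | nil => exact fun u b _ => ⟨_, (Exec.while_nil rfl).mono (by simp)⟩
  | cons a v ih =>
    intro u b huv
    obtain ⟨S, h⟩ := ih (u ++ [a]) _ (by simpa using huv)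
    refine ⟨S, (Exec.while_cons (by simp [Mem.stacks, encodeList_cons])
      (exec_askEntry hR hc hn huv) h).mono ?_⟩
    rw [List.length_cons, add_one_mul]
    omega

/-! ### The whole reduction and its running time -/

/-- Split the input, and prepare a large number. -/
def readInput : Prog Stk :=
  .seq (copyRev .inp .big .tmp fun _ => [.bit true]) <|
  .seq (.move .inp (fun s => s = .semicolon) .tmp (fun s => [s]) .val fun _ => []) <|
  .seq (.move .tmp (fun _ => false) .todo (fun s => [s]) .val fun _ => []) <|
  .move .inp (fun s => s = .semicolon) .dim (fun s => [s]) .val fun _ => []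

/-- One digit is pushed for each symbol before the input is taken apart, and these digits form the
large constant. The vector is moved twice to keep its orientation. -/
theorem exec_readInput {n : ℕ} {v : List ZInf} {R w : List Symbol}
    (hw : w = encodeList v ++ Symbol.semicolon ::
      (List.replicate n (Symbol.bit true) ++ Symbol.semicolon :: R)) :
    Exec O .query readInput b (Function.update (fun _ => []) .inp w) b
      (Mem.mk R [] (encodeList v) [] [] (List.replicate n (.bit true))
        (encodeEntry ((2 ^ w.length - 1 : ℤ) : ZInf)).reverse [] [] [] []).stacks
      (10 * w.length + 5) := by
  have hlen := congrArg List.length hw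
  simp only [List.length_append, List.length_cons, List.length_replicate] at hlen
  have h0 : Function.update (fun _ => []) Stk.inp w =
      (Mem.mk w [] [] [] [] [] [] [] [] [] []).stacks := by
    funext k
    cases k <;> rfl
  have hones : ∀ u : List Symbol, (u.flatMap fun _ => [Symbol.bit true]) =
      List.replicate u.length (.bit true) := by
    intro u
    induction u with
    | nil => rfl
    | cons s u ih => rw [List.flatMap_cons, ih]; rfl
  have hnil : ∀ u : List Symbol, (u.flatMap fun _ => ([] : List Symbol)) = [] := by
    intro u
    induction u with
    | nil => rfl
    | cons s u ih => rw [List.flatMap_cons, ih]; rfl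
  rw [h0]
  refine ((exec_copyRev (W := w.length) (by decide) (by decide) (by decide) rfl le_rfl).seq
    ((exec_move (by decide) (by decide) (by decide)
      (rest := .semicolon :: (List.replicate n (.bit true) ++ .semicolon :: R))
      (Or.inr ⟨.semicolon, by simp, rfl⟩) (encodeList v) _ ?_ ?_).seq
    ((exec_move (by decide) (by decide) (by decide)
      (rest := []) (Or.inl ⟨rfl, rfl⟩) (encodeList v).reverse _ ?_ (fun _ _ => rfl)).seq
    (exec_move (by decide) (by decide) (by decide)
      (rest := .semicolon :: R) (Or.inr ⟨.semicolon, by simp, rfl⟩)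
      (List.replicate n (Symbol.bit true)) _ ?_ ?_)))).congr ?_ ?_
  · simpa [Mem.stacks] using hw
  · intro s hs
    exact decide_eq_false fun h => semicolon_notMem_encodeList v (h ▸ hs)
  · simp [Mem.stacks]
  · simp [Mem.stacks]
  · intro s hs
    simp [List.eq_of_mem_replicate hs]
  · rw [List.length_reverse, List.length_replicate]
    omega
  · rw [encodeEntry_two_pow_sub_one]
    simp [Mem.stacks, hones, hnil]

/-- The reduction. -/
def reduction : Prog Stk :=
  .seq readInput <|
  .seq (.move .dim (fun _ => true) .query (fun _ => []) .tmp fun _ => []) <|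
  .ifEmpty .dim (.ifEmpty .inp (.ifEmpty .todo (.pushes []) .reject) (.pushes [])) <|
  .seq (.pushes [(.dim, .bit true)]) askEntries

/-- The verdict of the reduction. -/
noncomputable def answer (O : Set (List Symbol)) (v : List ZInf) (rows : List (List ZInf))
    (c : ZInf) : Bool :=
  if v.length = 0 then true else if v.length = 1 then !rows.isEmpty else
    verdict O v.length rows c [] v true

theorem exec_reduction {v : List ZInf} {rows : List (List ZInf)} {w : List Symbol}
    (hw : w = encodeList v ++ Symbol.semicolon ::
      (List.replicate v.length (Symbol.bit true) ++ Symbol.semicolon :: encodeRows rows)) :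
    ∃ S, Exec O .query reduction true (Function.update (fun _ => []) .inp w)
      (answer O v rows ((2 ^ w.length - 1 : ℤ) : ZInf)) S
      ((w.length + 2) * (44 * (w.length + 2) * (w.length + 2) + 82 * (w.length + 2) + 60)) := by
  have h1 := exec_readInput (O := O) (b := true) hw
  have hlen := congrArg List.length hw
  simp only [List.length_append, List.length_cons, List.length_replicate] at hlen
  have hbig : (encodeEntry ((2 ^ w.length - 1 : ℤ) : ZInf)).length = w.length := by
    rw [encodeEntry_two_pow_sub_one, List.length_replicate]
  have hpop : ∀ (m : Mem) (d : List Symbol), (m.dim = [] ∧ d = []) ∨ (∃ s, m.dim = s :: d) →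
      Exec O .query (.move .dim (fun _ => true) .query (fun _ => []) .tmp fun _ => []) true
        m.stacks true { m with dim := d }.stacks 1 := by
    intro m d hd
    refine (exec_move (rest := m.dim) (r := d) (by decide) (by decide) (by decide) ?_ [] m.stacks
      rfl (by simp)).congr (t' := 1) (by simp) (by simp [Mem.stacks])
    simpa using hd
  -- One symbol has been popped from `dim`, so `dim` is empty exactly for at most one column; the
  -- truncated `v.length - 1` also covers none. Among these cases only one column without rows is
  -- rejected. Otherwise the symbol is put back.
  have hlast : ∃ S, Exec O .query
      (.ifEmpty .dim (.ifEmpty .inp (.ifEmpty .todo (.pushes []) .reject) (.pushes [])) <|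
        .seq (.pushes [(.dim, .bit true)]) askEntries) true
      (Mem.mk (encodeRows rows) [] (encodeList v) [] [] (List.replicate (v.length - 1) (.bit true))
        (encodeEntry ((2 ^ w.length - 1 : ℤ) : ZInf)).reverse [] [] [] []).stacks
      (answer O v rows ((2 ^ w.length - 1 : ℤ) : ZInf)) S
      (v.length * (44 * (w.length + 2) * (w.length + 2) + 82 * (w.length + 2) + 37) + 4) := by
    rcases v with _ | ⟨a, _ | ⟨a', v⟩⟩
    · rw [show answer O [] rows ((2 ^ w.length - 1 : ℤ) : ZInf) = true from rfl]
      by_cases hR : encodeRows rows = []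
      · refine ⟨_, (Exec.ifEmpty_nil rfl
          (.ifEmpty_nil (by exact hR) (.ifEmpty_nil rfl (.pushes _ _ _)))).mono ?_⟩
        omega
      · refine ⟨_, (Exec.ifEmpty_nil rfl (.ifEmpty_cons (by exact hR) (.pushes _ _ _))).mono ?_⟩
        omega
    · rcases rows with _ | ⟨r, rows⟩
      · rw [show answer O [a] [] ((2 ^ w.length - 1 : ℤ) : ZInf) = false from rfl]
        exact ⟨_, (Exec.ifEmpty_nil rfl (.ifEmpty_nil rfl
          (.ifEmpty_cons (by simp [Mem.stacks, encodeList_cons]) (.reject _ _)))).mono (by omega)⟩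
      · rw [show answer O [a] (r :: rows) ((2 ^ w.length - 1 : ℤ) : ZInf) = true from rfl]
        exact ⟨_, (Exec.ifEmpty_nil rfl
          (.ifEmpty_cons (by simp [Mem.stacks, encodeRows_cons]) (.pushes _ _ _))).mono (by omega)⟩
    · rw [show answer O (a :: a' :: v) rows ((2 ^ w.length - 1 : ℤ) : ZInf) =
        verdict O (a :: a' :: v).length rows ((2 ^ w.length - 1 : ℤ) : ZInf) [] (a :: a' :: v) true
        from rfl]
      obtain ⟨S, h⟩ := exec_askEntries (O := O) (W := w.length + 2) (rows := rows)
        (n := (a :: a' :: v).length) (by omega) (hbig.trans_le (by omega)) (by omega)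
        (a :: a' :: v) [] true (by rw [List.nil_append]; omega)
      refine ⟨S, (Exec.ifEmpty_cons (by simp [Mem.stacks, List.replicate_succ])
        (((Exec.pushes _ _ _).congr le_rfl ?_).seq h)).mono (by omega)⟩
      simp [pushAll, Mem.stacks, List.replicate_succ, encodeList_nil]
  obtain ⟨S, h2⟩ := hlast
  refine ⟨S, (h1.seq ((hpop _ (List.replicate (v.length - 1) (.bit true)) ?_).seq h2)).mono ?_⟩
  · rcases v with _ | ⟨a, v⟩
    · exact Or.inl ⟨rfl, rfl⟩
    · exact Or.inr ⟨.bit true, by simp [List.replicate_succ]⟩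
  · have : v.length * (44 * (w.length + 2) * (w.length + 2) + 82 * (w.length + 2) + 37) ≤
        (w.length + 2) * (44 * (w.length + 2) * (w.length + 2) + 82 * (w.length + 2) + 37) :=
      Nat.mul_le_mul_right _ (by omega)
    nlinarith

/-! ### Correctness of the verdict -/

theorem mem_coefRows {c d : ZInf} {r : List ZInf} :
    ∀ (v : List ZInf) (i : ℕ), r ∈ coefRows c d i v ↔ ∃ k, ∃ h : k < v.length,
      r = unitList (i + k) c (v.length - 1 - k) d ∨
        r = unitList (i + k) v[k] (v.length - 1 - k) d := by
  intro v
  induction v with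
  | nil => simp [coefRows]
  | cons a v ih =>
    intro i
    have hlen : ∀ k, (a :: v).length - 1 - (k + 1) = v.length - 1 - k := fun k => by
      rw [List.length_cons]
      omega
    simp only [coefRows, List.mem_append, ih, List.mem_cons, List.not_mem_nil, or_false]
    constructor
    · rintro (⟨k, h, hr⟩ | hr)
      · refine ⟨k + 1, by simpa using h, ?_⟩
        rw [List.getElem_cons_succ, ← add_assoc, add_right_comm, hlen]
        exact hr
      · exact ⟨0, by simp, by simpa using hr⟩
    · rintro ⟨_ | k, h, hr⟩
      · right
        simpa using hr
      · left
        refine ⟨k, by simpa using h, ?_⟩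
        rw [List.getElem_cons_succ, ← add_assoc, add_right_comm, hlen] at hr
        exact hr

theorem ofFn_extend_unitRow {n : ℕ} (k : Fin n) (c a b : ZInf) :
    List.ofFn (extend (unitRow k c) a b) =
      List.replicate k ⊤ ++ c :: List.replicate (n - 1 - k) ⊤ ++ [a, b] := by
  rw [ofFn_extend, ofFn_unitRow]

theorem take_append_top_drop {n : ℕ} (l : Fin n → ZInf) (j : Fin n) :
    (List.ofFn l).take j ++ ⊤ :: (List.ofFn l).drop (j + 1) =
      List.ofFn (Function.update l j ⊤) := by
  refine List.ext_getElem (by simp; omega) fun i h1 h2 => ?_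
  rw [List.length_ofFn] at h2
  rw [List.getElem_ofFn, List.getElem_append]
  split_ifs with h
  · rw [List.length_take, List.length_ofFn] at h
    rw [Function.update_of_ne (by simp [Fin.ext_iff]; omega)]
    simp
  · simp only [List.length_take, List.length_ofFn] at h ⊢
    rcases Nat.eq_or_lt_of_le (show (j : ℕ) ≤ i by omega) with h' | h'
    · subst h'
      simp
    · rw [List.getElem_cons, dif_neg (by omega),
        Function.update_of_ne (by simp [Fin.ext_iff]; omega)]
      simp only [List.getElem_drop, List.getElem_ofFn]
      congr 2
      omega

theorem ofFn_mem_queryList {m n : ℕ} (A : Matrix (Fin m) (Fin n) ZInf) (l : Fin n → ZInf) (C : ℤ)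
    (j : Fin n) (r : List ZInf) :
    r ∈ queryList ((List.ofFn A).map List.ofFn) C ((List.ofFn l).take j) (l j)
      ((List.ofFn l).drop (j + 1)) ↔ ∃ s ∈ queryRows A l C j, r = List.ofFn s := by
  have hj := j.isLt
  have hlt : ((List.ofFn l).take j).length = j := by
    rw [List.length_take, List.length_ofFn]
    omega
  have hld : ((List.ofFn l).drop (j + 1)).length = n - 1 - j := by
    rw [List.length_drop, List.length_ofFn]
    omega
  rw [queryList, take_append_top_drop, hlt, hld]
  have hA : ∀ r, r ∈ List.ofFn A ↔ ∃ i, A i = r := fun r => List.mem_ofFn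
  simp only [List.mem_append, List.mem_cons, mem_coefRows, List.mem_map, hA,
    List.length_ofFn, zero_add, List.getElem_ofFn, queryRows, Set.mem_ofPred_eq, unitList]
  constructor
  · rintro (⟨_, ⟨_, ⟨i, rfl⟩, rfl⟩, rfl⟩ | rfl | rfl | ⟨k, hk, rfl | rfl⟩)
    · exact ⟨_, Or.inr (Or.inr (Or.inl ⟨i, rfl⟩)), (ofFn_extend _ _ _).symm⟩
    · exact ⟨_, Or.inr (Or.inl rfl), (ofFn_extend_unitRow _ _ _ _).symm⟩
    · exact ⟨_, Or.inl rfl, (ofFn_extend_unitRow _ _ _ _).symm⟩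
    · exact ⟨_, Or.inr (Or.inr (Or.inr (Or.inl ⟨⟨k, hk⟩, rfl⟩))),
        (ofFn_extend_unitRow ⟨k, hk⟩ _ _ _).symm⟩
    · exact ⟨_, Or.inr (Or.inr (Or.inr (Or.inr ⟨⟨k, hk⟩, rfl⟩))),
        (ofFn_extend_unitRow ⟨k, hk⟩ _ _ _).symm⟩
  · rintro ⟨s, rfl | rfl | ⟨i, rfl⟩ | ⟨k, rfl⟩ | ⟨k, rfl⟩, rfl⟩
    · exact Or.inr (Or.inr (Or.inl (ofFn_extend_unitRow _ _ _ _)))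
    · exact Or.inr (Or.inl (ofFn_extend_unitRow _ _ _ _))
    · exact Or.inl ⟨_, ⟨_, ⟨i, rfl⟩, rfl⟩, (ofFn_extend _ _ _).symm⟩
    · exact Or.inr (Or.inr (Or.inr ⟨k, k.isLt, Or.inl (ofFn_extend_unitRow _ _ _ _)⟩))
    · exact Or.inr (Or.inr (Or.inr ⟨k, k.isLt, Or.inr (ofFn_extend_unitRow _ _ _ _)⟩))

/-- The program produces lists of entries, whereas an instance consists of vectors. Every listed row
is some `List.ofFn s` with `s` of length `n + 2`, so the list of vectors can be recovered. -/
theorem exists_queryList_eq_map {m n : ℕ} (A : Matrix (Fin m) (Fin n) ZInf) (l : Fin n → ZInf)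
    (C : ℤ) (j : Fin n) :
    ∃ rows : List (Fin (n + 2) → ZInf), (∀ r, r ∈ rows ↔ r ∈ queryRows A l C j) ∧
      queryList ((List.ofFn A).map List.ofFn) C ((List.ofFn l).take j) (l j)
        ((List.ofFn l).drop (j + 1)) = rows.map List.ofFn := by
  obtain ⟨rows, h⟩ : queryList ((List.ofFn A).map List.ofFn) C ((List.ofFn l).take j) (l j)
      ((List.ofFn l).drop (j + 1)) ∈ Set.range (List.map (List.ofFn (n := n + 2))) := by
    rw [Set.range_list_map]
    intro r hr
    obtain ⟨s, -, rfl⟩ := (ofFn_mem_queryList A l C j r).1 hr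
    exact ⟨s, rfl⟩
  refine ⟨rows, fun r => ?_, h.symm⟩
  rw [← List.mem_map_of_injective (List.ofFn_injective (n := n + 2)), h, ofFn_mem_queryList]
  constructor
  · rintro ⟨s, hs, e⟩
    rwa [List.ofFn_injective e]
  · exact fun hr => ⟨r, hr, rfl⟩

theorem answer_eq_true_iff {m n : ℕ} (A : Matrix (Fin m) (Fin n) ZInf) (l : Fin n → ZInf) {W : ℕ}
    (hW : W = (encodeVector l ++ Symbol.semicolon :: encodeMatrix A).length) :
    answer TropSolvInf.language (List.ofFn l) ((List.ofFn A).map List.ofFn)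
      ((2 ^ W - 1 : ℤ) : ZInf) = true ↔ Implies A l := by
  rw [answer, List.length_ofFn]
  split_ifs with h0 h1
  · subst h0
    simp [implies_of_eq_zero]
  · subst h1
    rw [implies_one_iff]
    have hA : (List.ofFn A).length = m := List.length_ofFn
    simp [← List.length_eq_zero_iff, hA]
  · choose rows hrows hlist using exists_queryList_eq_map A l (2 ^ W - 1)
    rw [verdict_eq_true, implies_iff_notMem_language (by omega) A l hW rows hrows]
    simp only [true_and, List.nil_append, queryWord]
    constructor
    · intro h j
      rw [← hlist]
      refine h _ _ _ ?_
      have := List.take_append_drop (j : ℕ) (List.ofFn l)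
      rw [List.drop_eq_getElem_cons (by simp), List.getElem_ofFn] at this
      exact this.symm
    -- A splitting of the vector is the splitting at column `u.length`.
    · intro h u a v huv
      have hlen := congrArg List.length huv
      rw [List.length_ofFn, List.length_append, List.length_cons] at hlen
      have hj := h ⟨u.length, by omega⟩
      rw [← hlist] at hj
      have ha : l ⟨u.length, by omega⟩ = a := by
        have : (List.ofFn l)[u.length]'(by rw [List.length_ofFn]; omega) = a := by simp [huv]
        rwa [List.getElem_ofFn] at this
      rw [ha] at hj
      simpa [huv] using hj

theorem tropImplInf_reducible : PolyTimeTuringReducible TropImplInf TropSolvInf := by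
  classical
  refine ⟨reduction.machine .inp .query, (.X + 2) * (44 * (.X + 2) * (.X + 2) +
    82 * (.X + 2) + 60) + 1, fun a => ?_⟩
  obtain ⟨m, n, A, l⟩ := a
  obtain ⟨S, h⟩ := exec_reduction (O := TropSolvInf.language) (v := List.ofFn l)
    (rows := (List.ofFn A).map List.ofFn)
    (w := encodeVector l ++ Symbol.semicolon :: encodeMatrix A)
    (by simp [encodeMatrix_eq, encodeVector_eq])
  have hb : decide (Implies A l) = answer TropSolvInf.language (List.ofFn l)
      ((List.ofFn A).map List.ofFn)
      ((2 ^ (encodeVector l ++ Symbol.semicolon :: encodeMatrix A).length - 1 : ℤ) : ZInf) := by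
    rw [Bool.eq_iff_iff, decide_eq_true_iff, answer_eq_true_iff A l rfl]
  have h' := h.haltsWithin
  rw [← hb] at h'
  have hp : ∀ W : ℕ, ((.X + 2) * (44 * (.X + 2) * (.X + 2) + 82 * (.X + 2) + 60) + 1 :
      Polynomial ℕ).eval W =
        (W + 2) * (44 * (W + 2) * (W + 2) + 82 * (W + 2) + 60) + 1 := by
    intro W
    simp
  rw [hp]
  exact h'

end TropicalReduction

theorem mainTheorem12 :
    TropicalReduction.PolyTimeTuringReducible
      TropicalReduction.TropImplInf TropicalReduction.TropSolvInf :=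
  TropicalReduction.tropImplInf_reducible
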